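/- For $\alpha,\beta>-1$ let $$R_n^{(\alpha,\beta)}(x)=\sum_{k=0}^n\frac{(-n)_k\,(n+\alpha+\beta+1)_k}{(\alpha+1)_k}\,\frac{(1-x)^k}{2^k\,k!}\qquad(n\in\mathbb{N}_0)$$ be the Jacobi polynomials normalized by $R_n^{(\alpha,\beta)}(1)=1$, where $(c)_0=1$ and $(c)_k=c(c+1)\cdots(c+k-1)$, and let the generalized Chebyshev polynomials be given by $$T_{2n}^{(\alpha,\beta)}(x)=R_n^{(\alpha,\beta)}(2x^2-1),\qquad T_{2n+1}^{(\alpha,\beta)}(x)=x\,R_n^{(\alpha,\beta+1)}(2x^2-1)\qquad(n\in\mathbb{N}_0).$$ Since $\deg T_n^{(\alpha,\beta)}=n$, these polynomials form a basis of $\mathbb{R}[x]$. The linearization coefficients $g_T(m,n;k)$, where $m,n\in\mathbb{N}_0$ and $|m-n|\le k\le m+n$, are the coefficients of $T_k^{(\alpha,\beta)}$ in the expansion of $T_m^{(\alpha,\beta)}T_n^{(\alpha,\beta)}$ with respect to this basis (by orthogonality, only indices $k$ in this range occur). Put $a=\alpha+\beta+1$, $b=\alpha-\beta$, and define $$V=\{(\alpha,\beta)\in(-1,\infty)^2: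 a(a+5)(a+3)^2\ge(a^2-7a-24)b^2,\ b\ge0\},$$ $$V'=\{(\alpha,\beta)\in(-1,\infty)^2: a^2+2b^2+3a\ge0,\ b\ge0\},\qquad \Delta=\{(\alpha,\beta)\in(-1,\infty)^2: a\ge0,\ b\ge0\}.$$ **Theorem 3.1.** Let $\alpha,\beta>-1$. The following are equivalent: (i) For all $m,n\in\mathbb{N}_0$ such that at least one of $m,n$ is odd, all linearization coefficients $g_T(m,n;k)$, $|m-n|\le k\le m+n$, are nonnegative. (ii) $(\alpha,\beta)\in V'$. Moreover, $V\subsetneq V'$. If $(\alpha,\beta)\in V'\setminus\Delta$, if $m,n\in\mathbb{N}_0$ are such that at least one of them is odd, and if $k\in\{|m-n|,\ldots,m+n\}$ is such that $m+n-k$ is even, then $g_T(m,n;k)>0$. -/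

import Mathlib

open Polynomial

noncomputable section

/-- The Jacobi polynomial `R_n^{(α,β)}`, normalized so that its value at `1` is `1`:
`∑_{k ≤ n} (-n)_k (n+α+β+1)_k / (α+1)_k * (1-x)^k / (2^k k!)`, where
`(c)_k = (ascPochhammer ℝ k).eval c` is the Pochhammer symbol. -/
def jacobiR (α β : ℝ) (n : ℕ) : ℝ[X] :=
  ∑ k ∈ Finset.range (n + 1),
    C ((ascPochhammer ℝ k).eval (-(n : ℝ)) * (ascPochhammer ℝ k).eval ((n : ℝ) + α + β + 1)
        / (ascPochhammer ℝ k).eval (α + 1) / (2 ^ k * (k.factorial : ℝ))) * (1 - X) ^ k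

/-- The generalized Chebyshev polynomials:
`T_{2n}(x) = R_n^{(α,β)}(2x²-1)` and `T_{2n+1}(x) = x R_n^{(α,β+1)}(2x²-1)`. -/
def genChebT (α β : ℝ) (n : ℕ) : ℝ[X] :=
  if Even n then (jacobiR α β (n / 2)).comp (2 * X ^ 2 - 1)
  else X * (jacobiR α (β + 1) (n / 2)).comp (2 * X ^ 2 - 1)

theorem jacobiR_degree {α β : ℝ} (hα : -1 < α) (hβ : -1 < β) (n : ℕ) :
    (jacobiR α β n).degree = n := by
  have h1 : (1 - X : ℝ[X]).degree = 1 := by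
    have : (1 - X : ℝ[X]) = -(X - C 1) := by simp
    rw [this, degree_neg, degree_X_sub_C]
  have hk : ∀ (c : ℝ) (k : ℕ), (C c * (1 - X : ℝ[X]) ^ k).degree ≤ k := by
    intro c k
    rw [degree_mul, degree_pow, h1]
    refine (add_le_add_left degree_C_le _).trans ?_
    simp
  unfold jacobiR
  rw [Finset.sum_range_succ]
  have hlast : (C ((ascPochhammer ℝ n).eval (-(n : ℝ))
        * (ascPochhammer ℝ n).eval ((n : ℝ) + α + β + 1)
        / (ascPochhammer ℝ n).eval (α + 1) / (2 ^ n * (n.factorial : ℝ)))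
        * (1 - X : ℝ[X]) ^ n).degree = n := by
    rw [degree_C_mul, degree_pow, h1]
    · simp
    have e1 : (ascPochhammer ℝ n).eval (-(n : ℝ)) ≠ 0 := by
      rw [ascPochhammer_eval_neg_eq_descPochhammer, descPochhammer_eval_eq_descFactorial,
        Nat.descFactorial_self]
      positivity
    have e2 : (ascPochhammer ℝ n).eval ((n : ℝ) + α + β + 1) ≠ 0 := by
      rcases Nat.eq_zero_or_pos n with rfl | hn
      · simp
      · have : (1 : ℝ) ≤ n := by exact_mod_cast hn
        exact (ascPochhammer_pos n _ (by linarith)).ne'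
    have e3 : (ascPochhammer ℝ n).eval (α + 1) ≠ 0 :=
      (ascPochhammer_pos n _ (by linarith)).ne'
    positivity
  rw [degree_add_eq_right_of_degree_lt, hlast]
  rw [hlast]
  refine (degree_sum_le _ _).trans_lt ?_
  refine (Finset.sup_lt_iff (WithBot.bot_lt_coe n)).mpr ?_
  intro k hkn
  exact (hk _ k).trans_lt ((Nat.cast_lt (α := WithBot ℕ)).mpr (Finset.mem_range.mp hkn))

theorem genChebT_degree {α β : ℝ} (hα : -1 < α) (hβ : -1 < β) (n : ℕ) :
    (genChebT α β n).degree = n := by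
  have hq : (2 * X ^ 2 - 1 : ℝ[X]).natDegree = 2 := by
    have : (2 * X ^ 2 - 1 : ℝ[X]) = C 2 * X ^ 2 - C 1 := by
      rw [C_1, show (C (2 : ℝ) : ℝ[X]) = 2 from rfl]
    rw [this, natDegree_sub_C, natDegree_C_mul_X_pow 2 (2 : ℝ) (by norm_num)]
  have key : ∀ γ : ℝ, -1 < γ → ∀ k : ℕ,
      ((jacobiR α γ k).comp (2 * X ^ 2 - 1)).degree = ((2 * k : ℕ) : WithBot ℕ) := by
    intro γ hγ k
    have hd : (jacobiR α γ k).natDegree = k :=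
      natDegree_eq_of_degree_eq_some (jacobiR_degree hα hγ k)
    have hn : ((jacobiR α γ k).comp (2 * X ^ 2 - 1)).natDegree = 2 * k := by
      rw [natDegree_comp, hd, hq, mul_comm]
    rcases Nat.eq_zero_or_pos k with rfl | hkp
    · simp [jacobiR]
    · exact (degree_eq_iff_natDegree_eq_of_pos (by omega)).mpr hn
  unfold genChebT
  split_ifs with h
  · rw [key β hβ]
    obtain ⟨r, rfl⟩ := h
    congr 1
    omega
  · rw [degree_mul, key (β + 1) (by linarith), degree_X]
    rw [Nat.not_even_iff_odd] at h
    obtain ⟨r, rfl⟩ := h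
    have : (2 * r + 1) / 2 = r := by omega
    rw [this]
    push_cast
    ring

/-- For `α, β > -1`, the generalized Chebyshev polynomials as a sequence with `deg T_n = n`. -/
def genChebSeq {α β : ℝ} (hα : -1 < α) (hβ : -1 < β) : Polynomial.Sequence ℝ where
  elems' := genChebT α β
  degree_eq' := genChebT_degree hα hβ

/-- The basis `(T_n)` of `ℝ[x]`. -/
def genChebBasis {α β : ℝ} (hα : -1 < α) (hβ : -1 < β) : Module.Basis ℕ ℝ ℝ[X] :=
  (genChebSeq hα hβ).basis fun i =>
    (leadingCoeff_ne_zero.mpr ((genChebSeq hα hβ).ne_zero i)).isUnit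

/-- The linearization coefficient `g_T(m,n;k)`: the coefficient of `T_k` in the expansion of
`T_m T_n` with respect to the basis `(T_k)`. -/
def gT {α β : ℝ} (hα : -1 < α) (hβ : -1 < β) (m n k : ℕ) : ℝ :=
  (genChebBasis hα hβ).repr (genChebT α β m * genChebT α β n) k

/-- The set `V`, with `a = α + β + 1` and `b = α - β`. -/
def setV : Set (ℝ × ℝ) :=
  {p | -1 < p.1 ∧ -1 < p.2 ∧
    let a := p.1 + p.2 + 1
    let b := p.1 - p.2
    a * (a + 5) * (a + 3) ^ 2 ≥ (a ^ 2 - 7 * a - 24) * b ^ 2 ∧ b ≥ 0}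

/-- The set `V'`, with `a = α + β + 1` and `b = α - β`. -/
def setV' : Set (ℝ × ℝ) :=
  {p | -1 < p.1 ∧ -1 < p.2 ∧
    let a := p.1 + p.2 + 1
    let b := p.1 - p.2
    a ^ 2 + 2 * b ^ 2 + 3 * a ≥ 0 ∧ b ≥ 0}

/-- The set `Δ`, with `a = α + β + 1` and `b = α - β`. -/
def setDelta : Set (ℝ × ℝ) :=
  {p | -1 < p.1 ∧ -1 < p.2 ∧
    let a := p.1 + p.2 + 1
    let b := p.1 - p.2
    a ≥ 0 ∧ b ≥ 0}

end

/-! Put a = α + β + 1, b = α - β. Up to a positive norm, g_T(m,n;k) is the value of the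
orthogonality functional on T_m T_n T_k (`gT_mul_norm`), which is symmetric in all three indices. It
vanishes when m + n + k is odd, so as soon as one of m, n is odd, only triples with exactly two odd
indices matter. They are written O(m,n,k) below (`oddTriple`), the even index last.

The Jacobi operator is symmetric for the functional. Applied to well-chosen polynomials this gives
relations between neighbouring triple products. `oddTriple_even_relation` and its mirror image share
an all-even product; eliminating it yields `oddTriple_step`, which expresses O(m+1,n,k) through
O(m,n+1,k) and O(m,n,k). Suppose the odd index n dominates and let e = k + m - n. The only factors
of unclear sign are then a bracket, positive or nonnegative in the cases at hand, and e - 1 + a. For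
e = 0 the product multiplied by e - 1 + a vanishes, so for a, b ≥ 0 induction on m gives
nonnegativity. For a < 0 only e = 1 is bad. There the product is two steps below the extremal one,
and the closed form `oddTriple_third_top` together with `third_top_inequality` replaces the
induction step.

When the even index dominates, the Wronskian relation `oddTriple_relation` reduces to the previous
case. Its one bad instance for a < 0 is again covered by a closed form
(`oddTriple_second_top_even_pos`).

Conversely, the closed forms for O(m+1,m+1,1) and O(m+2,m+2,2), suitably rescaled, tend to b and a²
+ 2b² + 3a as m → ∞; this is where V' comes from. On V' with a < 0, the condition β > -1 forces -1/3
< a and 0 < b < 1, the range in which the estimates work. -/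

noncomputable section

/-! ### Jacobi polynomials in the variable z: coefficients and contiguous relations -/

/-- The coefficient of `z ^ k` in the Jacobi polynomial, `z = (1 - x) / 2` and `c = α + β + 1`. -/
def jacCoeff (α c : ℝ) (n k : ℕ) : ℝ :=
  (ascPochhammer ℝ k).eval (-(n : ℝ)) * (ascPochhammer ℝ k).eval ((n : ℝ) + c)
    / ((ascPochhammer ℝ k).eval (α + 1) * (k.factorial : ℝ))

/-- The Jacobi polynomial as a polynomial in `z = (1 - x) / 2`, with `c = α + β + 1`. -/
def jacZ (α c : ℝ) (n : ℕ) : ℝ[X] :=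
  ∑ k ∈ Finset.range (n + 1), C (jacCoeff α c n k) * X ^ k

theorem ascPochhammer_eval_succ_left (k : ℕ) (x : ℝ) :
    x * (ascPochhammer ℝ k).eval (x + 1) = (ascPochhammer ℝ k).eval x * (x + k) := by
  rw [← ascPochhammer_succ_eval, ascPochhammer_succ_left]
  simp

theorem jacCoeff_eq_zero (α c : ℝ) {n k : ℕ} (h : n < k) : jacCoeff α c n k = 0 := by
  have : (ascPochhammer ℝ k).eval (-(n : ℝ)) = 0 := by
    rw [ascPochhammer_eval_neg_eq_descPochhammer, descPochhammer_eval_eq_descFactorial,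
      Nat.descFactorial_of_lt h]
    simp
  simp [jacCoeff, this]

theorem coeff_jacZ (α c : ℝ) (n k : ℕ) : (jacZ α c n).coeff k = jacCoeff α c n k := by
  simp only [jacZ, finsetSum_coeff, coeff_C_mul_X_pow]
  by_cases h : k < n + 1
  · rw [Finset.sum_eq_single k]
    · simp
    · intro j _ hj; simp [hj.symm]
    · intro hk; exact absurd (Finset.mem_range.mpr h) hk
  · rw [jacCoeff_eq_zero α c (by omega : n < k)]
    refine Finset.sum_eq_zero fun j hj => ?_
    have := Finset.mem_range.mp hj
    rw [if_neg (by omega)]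

theorem jacCoeff_zero (α c : ℝ) (n : ℕ) : jacCoeff α c n 0 = 1 := by simp [jacCoeff]

theorem jacZ_zero (α c : ℝ) : jacZ α c 0 = 1 := by
  simp [jacZ, jacCoeff_zero]

theorem jacCoeff_succ {α : ℝ} (hα : -1 < α) (c : ℝ) (n k : ℕ) :
    jacCoeff α c n (k + 1) * ((α + 1 + k) * (k + 1))
      = jacCoeff α c n k * ((k - n) * (n + c + k)) := by
  have h1 : (ascPochhammer ℝ k).eval (α + 1) ≠ 0 := (ascPochhammer_pos k _ (by linarith)).ne'
  have h2 : (α + 1 + k : ℝ) ≠ 0 := by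
    have : (0 : ℝ) ≤ k := k.cast_nonneg
    linarith
  have h3 : (k.factorial : ℝ) ≠ 0 := by positivity
  simp only [jacCoeff, ascPochhammer_succ_eval, Nat.factorial_succ, Nat.cast_mul, Nat.cast_succ]
  field_simp
  ring

theorem jacCoeff_shift (α c : ℝ) (n k : ℕ) :
    (n + c) * jacCoeff α (c + 1) n k = (n + c + k) * jacCoeff α c n k := by
  have := ascPochhammer_eval_succ_left k ((n : ℝ) + c)
  simp only [jacCoeff, ← add_assoc]
  linear_combination (ascPochhammer ℝ k).eval (-(n : ℝ))
    / ((ascPochhammer ℝ k).eval (α + 1) * (k.factorial : ℝ)) * this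

theorem jacCoeff_shift_down (α c : ℝ) (n k : ℕ) :
    (n + 1) * jacCoeff α (c + 1) n k = (n + 1 - k) * jacCoeff α c (n + 1) k := by
  have := ascPochhammer_eval_succ_left k (-(n : ℝ) - 1)
  rw [sub_add_cancel] at this
  simp only [jacCoeff, Nat.cast_succ, neg_add', show (n : ℝ) + 1 + c = n + (c + 1) by ring]
  linear_combination -(ascPochhammer ℝ k).eval ((n : ℝ) + (c + 1))
    / ((ascPochhammer ℝ k).eval (α + 1) * (k.factorial : ℝ)) * this

theorem coeff_X_mul_derivative (f : ℝ[X]) (k : ℕ) :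
    (X * derivative f).coeff k = k * f.coeff k := by
  cases k with
  | zero => simp
  | succ k => rw [coeff_X_mul, coeff_derivative]; push_cast; ring

theorem X_mul_derivative_jacZ (α c : ℝ) (n : ℕ) :
    X * derivative (jacZ α c n) = C (n + c) * (jacZ α (c + 1) n - jacZ α c n) := by
  ext k
  rw [coeff_X_mul_derivative, coeff_C_mul, coeff_sub, coeff_jacZ, coeff_jacZ]
  linear_combination -jacCoeff_shift α c n k

theorem X_mul_derivative_jacZ_succ (α c : ℝ) (n : ℕ) :
    X * derivative (jacZ α c (n + 1))
      = C ((n : ℝ) + 1) * (jacZ α c (n + 1) - jacZ α (c + 1) n) := by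
  ext k
  rw [coeff_X_mul_derivative, coeff_C_mul, coeff_sub, coeff_jacZ, coeff_jacZ]
  linear_combination jacCoeff_shift_down α c n k

/-- The lowering relation from degree `2 n + 1` to degree `2 n`, with `c - α = β + 1`. -/
theorem jacZ_odd_lower {α : ℝ} (hα : -1 < α) (c : ℝ) (n : ℕ) :
    X * ((1 - X) * derivative (jacZ α (c + 1) n)) - C (c - α) * (X * jacZ α (c + 1) n)
      = C (n + c - α) * ((1 - X) * jacZ α (c + 1) n - jacZ α c n) := by
  have e : ∀ f : ℝ[X], X * ((1 - X) * derivative f) = X * derivative f - X * (X * derivative f) :=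
    fun f => by ring
  have e' : ∀ f : ℝ[X], (1 - X) * f = f - X * f := fun f => by ring
  ext k
  rw [e, e']
  cases k with
  | zero => simp [coeff_jacZ, jacCoeff_zero]
  | succ k =>
    simp only [coeff_sub, coeff_C_mul, coeff_X_mul_derivative, coeff_X_mul, coeff_derivative,
      coeff_jacZ]
    have h1 := jacCoeff_succ hα (c + 1) n k
    have h2 := jacCoeff_shift α c n k
    have h3 := jacCoeff_succ hα c n k
    have hk : (α + 1 + k : ℝ) * (k + 1) ≠ 0 := by
      have : (0 : ℝ) ≤ k := k.cast_nonneg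
      have : (0 : ℝ) < α + 1 + k := by linarith
      positivity
    apply mul_left_cancel₀ hk
    linear_combination (k + 1 - n - c + α : ℝ) * h1 + (n + c - α) * h3
      - (n + c - α) * (k - n) * h2

/-- The raising relation from degree `2 n + 1` to degree `2 n + 2`, with `c - α = β + 1`. -/
theorem jacZ_odd_raise {α : ℝ} (hα : -1 < α) (c : ℝ) (n : ℕ) :
    X * ((1 - X) * derivative (jacZ α (c + 1) n)) - C (c - α) * (X * jacZ α (c + 1) n)
      = C (n + α + 1) * (jacZ α c (n + 1) - (1 - X) * jacZ α (c + 1) n) := by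
  have e : ∀ f : ℝ[X], X * ((1 - X) * derivative f) = X * derivative f - X * (X * derivative f) :=
    fun f => by ring
  have e' : ∀ f : ℝ[X], (1 - X) * f = f - X * f := fun f => by ring
  ext k
  rw [e, e']
  cases k with
  | zero => simp [coeff_jacZ, jacCoeff_zero]
  | succ k =>
    simp only [coeff_sub, coeff_C_mul, coeff_X_mul_derivative, coeff_X_mul, coeff_derivative,
      coeff_jacZ]
    have h1 := jacCoeff_succ hα (c + 1) n k
    have h2 := jacCoeff_shift_down α c n k
    have h3 := jacCoeff_succ hα c (n + 1) k
    have hk : (α + 1 + k : ℝ) * (k + 1) ≠ 0 := by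
      have : (0 : ℝ) ≤ k := k.cast_nonneg
      have : (0 : ℝ) < α + 1 + k := by linarith
      positivity
    apply mul_left_cancel₀ hk
    push_cast at *
    linear_combination (k + 1 + n + α + 1 : ℝ) * h1 - (n + α + 1) * h3
      - (n + α + 1) * (n + 1 + c + k) * h2

/-- Two first-order formulas express the same derivative; subtracting them removes it. Together with
`jacZ_odd_add` this becomes the three-term recurrence of the T_n. -/
theorem jacZ_even_add (α c : ℝ) (n : ℕ) :
    C (2 * (n + 1) + c) * jacZ α c (n + 1)
      = C (n + 1 + c) * jacZ α (c + 1) (n + 1) + C (n + 1 : ℝ) * jacZ α (c + 1) n := by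
  have h1 := X_mul_derivative_jacZ α c (n + 1)
  have h2 := X_mul_derivative_jacZ_succ α c n
  simp only [map_add, map_mul, map_ofNat, map_one, map_natCast, Nat.cast_succ] at *
  linear_combination h1 - h2

theorem X_mul_derivative_jacZ_succ' (α c : ℝ) (n : ℕ) :
    C (2 * (n + 1) + c) * (X * derivative (jacZ α c (n + 1)))
      = C ((n + 1) * (n + 1 + c)) * (jacZ α (c + 1) (n + 1) - jacZ α (c + 1) n) := by
  have h1 := X_mul_derivative_jacZ α c (n + 1)
  have h2 := X_mul_derivative_jacZ_succ α c n
  simp only [map_add, map_mul, map_ofNat, map_one, map_natCast, Nat.cast_succ] at *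
  linear_combination (C c + (n + 1 : ℝ[X])) * h2 + (n + 1 : ℝ[X]) * h1

theorem jacZ_odd_add {α : ℝ} (hα : -1 < α) (c : ℝ) (n : ℕ) :
    C (2 * n + 1 + c) * ((1 - X) * jacZ α (c + 1) n)
      = C (n + α + 1) * jacZ α c (n + 1) + C (n + c - α) * jacZ α c n := by
  have h1 := jacZ_odd_lower hα c n
  have h2 := jacZ_odd_raise hα c n
  simp only [map_add, map_mul, map_sub, map_ofNat, map_one, map_natCast] at *
  linear_combination h2 - h1

/-! ### The Jacobi differential operator -/

/-- The Jacobi differential operator in the variable `z`. -/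
def jacOp (α c : ℝ) : ℝ[X] →ₗ[ℝ] ℝ[X] where
  toFun f := X * (1 - X) * derivative (derivative f)
    + (C (α + 1) - C (c + 1) * X) * derivative f
  map_add' f g := by simp only [map_add]; ring
  map_smul' r f := by simp only [RingHom.id_apply, smul_eq_C_mul, derivative_C_mul]; ring

theorem jacOp_apply (α c : ℝ) (f : ℝ[X]) : jacOp α c f = X * (1 - X) * derivative (derivative f)
    + (C (α + 1) - C (c + 1) * X) * derivative f := rfl

/-- Compared coefficientwise, the hypergeometric equation is exactly `jacCoeff_succ`. -/
theorem jacOp_jacZ {α : ℝ} (hα : -1 < α) (c : ℝ) (n : ℕ) :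
    jacOp α c (jacZ α c n) = - C (n * (n + c)) * jacZ α c n := by
  ext k
  have e : jacOp α c (jacZ α c n) = (X * derivative (derivative (jacZ α c n))
      + C (α + 1) * derivative (jacZ α c n))
      - (X * (X * derivative (derivative (jacZ α c n)))
        + C (c + 1) * (X * derivative (jacZ α c n))) := by
    rw [jacOp_apply]; ring
  have h := jacCoeff_succ hα c n k
  rw [e, neg_mul, coeff_neg]
  cases k with
  | zero =>
    simp only [coeff_sub, coeff_add, coeff_derivative, coeff_jacZ, mul_coeff_zero,
      coeff_X_zero]
    simp at h ⊢
    linear_combination h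
  | succ k =>
    simp only [coeff_sub, coeff_add, coeff_C_mul, coeff_X_mul_derivative, coeff_X_mul,
      coeff_derivative, coeff_jacZ]
    push_cast at *
    linear_combination h

theorem jacOp_mul (α c : ℝ) (f g : ℝ[X]) :
    jacOp α c (f * g) = jacOp α c f * g + f * jacOp α c g
      + 2 * (X * (1 - X)) * (derivative f * derivative g) := by
  simp only [jacOp_apply, derivative_mul, derivative_add]
  ring

/-- The operator with shifted parameter applied to the weighted Wronskian of two eigenfunctions. -/
theorem jacOp_wronskian {α c ν κ : ℝ} {f g : ℝ[X]} (hf : jacOp α c f = -C ν * f)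
    (hg : jacOp α c g = -C κ * g) :
    jacOp α (c + 1) (X * (derivative f * g - f * derivative g))
      = C c * (X * (derivative f * g - f * derivative g))
        - C (ν - κ) * (f * g) - C (ν - κ) * (X * derivative (f * g)) := by
  set W := derivative f * g - f * derivative g with hW
  -- Abel's argument: cross-multiplying the two eigenvalue equations gives a first-order equation
  -- for the Wronskian, and differentiating it gives the claim.
  have h1 : (1 - X) * derivative (X * W) = (C c * X - C α) * W - C (ν - κ) * (f * g) := by
    rw [jacOp_apply] at hf hg
    simp only [hW, derivative_mul, derivative_X, map_add, map_sub, map_one] at *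
    linear_combination g * hf - f * hg
  have h2 := congrArg derivative h1
  simp only [derivative_mul, derivative_sub, derivative_X, derivative_one, derivative_C,
    derivative_add] at h2
  rw [jacOp_apply]
  simp only [derivative_mul, derivative_X, derivative_one, map_add, map_one, map_sub] at *
  linear_combination X * h2 + h1

/-- An antiderivative, up to sign and a constant factor, of the polynomial of degree `n` with
shifted parameter. -/
def jacPrim (α c : ℝ) (n : ℕ) : ℝ[X] :=
  C (n + α + 1) * jacZ α c (n + 1) - C (n + 1 : ℝ) * ((1 - X) * jacZ α (c + 1) n)

theorem jacPrim_eq {α : ℝ} (hα : -1 < α) (c : ℝ) (n : ℕ) :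
    jacPrim α c n = C α * ((1 - X) * jacZ α (c + 1) n)
      + (X * ((1 - X) * derivative (jacZ α (c + 1) n)) - C (c - α) * (X * jacZ α (c + 1) n)) := by
  rw [jacZ_odd_raise hα, jacPrim]
  simp only [map_add, map_one]
  ring

theorem derivative_jacPrim {α : ℝ} (hα : -1 < α) (c : ℝ) (n : ℕ) :
    derivative (jacPrim α c n) = -C ((n + 1) * (n + c)) * jacZ α (c + 1) n := by
  have h := jacOp_jacZ hα (c + 1) n
  rw [jacOp_apply] at h
  rw [jacPrim_eq hα]
  simp only [derivative_mul, derivative_X, derivative_one, derivative_C, map_add, map_mul,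
    map_sub, map_one, map_natCast] at *
  linear_combination h

theorem jacOp_jacPrim {α : ℝ} (hα : -1 < α) (c : ℝ) (n : ℕ) :
    jacOp α c (jacPrim α c n)
      = -C ((n + 1) * (n + c)) * (jacPrim α c n + (1 - X) * jacZ α (c + 1) n) := by
  rw [jacOp_apply, derivative_jacPrim hα, jacPrim_eq hα]
  generalize ((n : ℝ) + 1) * (n + c) = π
  simp only [derivative_mul, derivative_neg, derivative_C, map_add, map_sub, map_one]
  ring

/-- As the derivative of `jacPrim` is a multiple of a shifted polynomial, the cross term of the
product rule involves f only through X f', which can be re-expanded in shifted polynomials. -/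
theorem jacOp_mul_jacPrim {α c ν : ℝ} (hα : -1 < α) {f : ℝ[X]} (hf : jacOp α c f = -C ν * f)
    (n : ℕ) :
    jacOp α c (f * jacPrim α c n) = -C (ν + (n + 1) * (n + c)) * (f * jacPrim α c n)
      - C ((n + 1) * (n + c)) * (f * ((1 - X) * jacZ α (c + 1) n))
      - C (2 * ((n + 1) * (n + c))) * (X * derivative f * ((1 - X) * jacZ α (c + 1) n)) := by
  rw [jacOp_mul, hf, jacOp_jacPrim hα, derivative_jacPrim hα]
  simp only [map_add, map_mul, map_ofNat]
  ring

theorem degree_jacZ {α c : ℝ} (hα : -1 < α) (hc : -1 < c) (n : ℕ) :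
    (jacZ α c n).degree = n := by
  refine degree_eq_of_le_of_coeff_ne_zero ?_ ?_
  · rw [degree_le_iff_coeff_zero]
    intro k hk
    rw [coeff_jacZ, jacCoeff_eq_zero α c (by exact_mod_cast hk)]
  · rw [coeff_jacZ]
    have e1 : (ascPochhammer ℝ n).eval (-(n : ℝ)) ≠ 0 := by
      rw [ascPochhammer_eval_neg_eq_descPochhammer, descPochhammer_eval_eq_descFactorial,
        Nat.descFactorial_self]
      positivity
    have e2 : (ascPochhammer ℝ n).eval ((n : ℝ) + c) ≠ 0 := by
      rcases Nat.eq_zero_or_pos n with rfl | hn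
      · simp
      · have : (1 : ℝ) ≤ n := by exact_mod_cast hn
        exact (ascPochhammer_pos n _ (by linarith)).ne'
    have e3 : (ascPochhammer ℝ n).eval (α + 1) ≠ 0 :=
      (ascPochhammer_pos n _ (by linarith)).ne'
    unfold jacCoeff
    positivity

/-- The sequence of Jacobi polynomials in the variable `z`. -/
def jacSeq {α c : ℝ} (hα : -1 < α) (hc : -1 < c) : Polynomial.Sequence ℝ where
  elems' := jacZ α c
  degree_eq' := degree_jacZ hα hc

theorem span_jacZ {α c : ℝ} (hα : -1 < α) (hc : -1 < c) :
    Submodule.span ℝ (Set.range (jacZ α c)) = ⊤ :=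
  (jacSeq hα hc).span fun i => (leadingCoeff_ne_zero.mpr ((jacSeq hα hc).ne_zero i)).isUnit

/-! ### Generalized Chebyshev polynomials and their three-term recurrence -/

/-- The substitution `z = 1 - x ^ 2`. -/
def zSubst : ℝ[X] →ₐ[ℝ] ℝ[X] := aeval (1 - X ^ 2)

theorem zSubst_X : zSubst X = 1 - X ^ 2 := by simp [zSubst]

theorem zSubst_C (r : ℝ) : zSubst (C r) = C r := by simp [zSubst]

theorem jacobiR_comp (α β : ℝ) (n : ℕ) :
    (jacobiR α β n).comp (2 * X ^ 2 - 1) = zSubst (jacZ α (α + β + 1) n) := by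
  simp only [jacobiR, jacZ, zSubst, map_sum]
  rw [← coe_compRingHom_apply, map_sum]
  refine Finset.sum_congr rfl fun k _ => ?_
  have h : (1 - (2 * X ^ 2 - 1) : ℝ[X]) = C 2 * (1 - X ^ 2) := by
    rw [show (C (2 : ℝ) : ℝ[X]) = 2 from rfl]; ring
  simp only [coe_compRingHom_apply, C_comp, sub_comp, one_comp, X_comp, map_mul, map_pow, aeval_X,
    aeval_C, algebraMap_eq, h, mul_pow]
  rw [← mul_assoc, ← C_pow, ← C_mul]
  congr 2
  rw [jacCoeff, show (n : ℝ) + (α + β + 1) = n + α + β + 1 by ring]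
  field_simp

theorem genChebT_two_mul (α β : ℝ) (n : ℕ) :
    genChebT α β (2 * n) = zSubst (jacZ α (α + β + 1) n) := by
  rw [genChebT, if_pos (even_two_mul n), jacobiR_comp, Nat.mul_div_cancel_left n two_pos]

theorem genChebT_two_mul_add_one (α β : ℝ) (n : ℕ) :
    genChebT α β (2 * n + 1) = X * zSubst (jacZ α (α + β + 1 + 1) n) := by
  rw [genChebT, if_neg (by simp), jacobiR_comp, show (2 * n + 1) / 2 = n by omega,
    show α + (β + 1) + 1 = α + β + 1 + 1 by ring]

/-- The coefficient of `T_{n-1}` in `x T_n`; the coefficient of `T_{n+1}` is `1 - chebC α β n`. -/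
def chebC (α β : ℝ) (n : ℕ) : ℝ :=
  if Even n then n / (2 * (n + α + β + 1)) else (n + 2 * β + 1) / (2 * (n + α + β + 1))

theorem chebC_zero (α β : ℝ) : chebC α β 0 = 0 := by simp [chebC]

theorem chebC_even (α β : ℝ) (n : ℕ) :
    chebC α β (2 * n) = n / (2 * n + α + β + 1) := by
  rw [chebC, if_pos (even_two_mul n)]
  push_cast
  rw [mul_div_mul_left _ _ two_ne_zero]

theorem chebC_odd (α β : ℝ) (n : ℕ) :
    chebC α β (2 * n + 1) = (n + β + 1) / (2 * n + α + β + 2) := by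
  rw [chebC, if_neg (by simp)]
  push_cast
  rw [show (2 * (n : ℝ) + 1 + 2 * β + 1) = 2 * (n + β + 1) by ring,
    mul_div_mul_left _ _ two_ne_zero]
  congr 1; ring

theorem chebC_pos {α β : ℝ} (hα : -1 < α) (hβ : -1 < β) {n : ℕ} (hn : 0 < n) :
    0 < chebC α β n := by
  obtain ⟨m, rfl | rfl⟩ := n.even_or_odd'
  · rw [chebC_even]
    have : (1 : ℝ) ≤ m := by exact_mod_cast (by omega : 1 ≤ m)
    exact div_pos (by linarith) (by linarith)
  · rw [chebC_odd]
    have : (0 : ℝ) ≤ m := m.cast_nonneg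
    exact div_pos (by linarith) (by linarith)

theorem one_sub_chebC_even {α β : ℝ} (hα : -1 < α) (hβ : -1 < β) {n : ℕ} (hn : 0 < n) :
    1 - chebC α β (2 * n) = (n + α + β + 1) / (2 * n + α + β + 1) := by
  have : (1 : ℝ) ≤ n := by exact_mod_cast hn
  have : 2 * (n : ℝ) + α + β + 1 ≠ 0 := by linarith
  rw [chebC_even, eq_div_iff this, sub_mul, div_mul_cancel₀ _ this]
  ring

theorem one_sub_chebC_odd {α β : ℝ} (hα : -1 < α) (hβ : -1 < β) (n : ℕ) :
    1 - chebC α β (2 * n + 1) = (n + α + 1) / (2 * n + α + β + 2) := by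
  have : (0 : ℝ) ≤ n := n.cast_nonneg
  have : 2 * (n : ℝ) + α + β + 2 ≠ 0 := by linarith
  rw [chebC_odd, eq_div_iff this, sub_mul, div_mul_cancel₀ _ this]
  ring

theorem one_sub_chebC_pos {α β : ℝ} (hα : -1 < α) (hβ : -1 < β) (n : ℕ) :
    0 < 1 - chebC α β n := by
  rcases Nat.eq_zero_or_pos n with rfl | hn
  · simp [chebC_zero]
  obtain ⟨m, rfl | rfl⟩ := n.even_or_odd'
  · rw [one_sub_chebC_even hα hβ (by omega)]
    have : (1 : ℝ) ≤ m := by exact_mod_cast (by omega : 1 ≤ m)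
    exact div_pos (by linarith) (by linarith)
  · rw [one_sub_chebC_odd hα hβ]
    have : (0 : ℝ) ≤ m := m.cast_nonneg
    exact div_pos (by linarith) (by linarith)

theorem X_mul_genChebT {α β : ℝ} (hα : -1 < α) (hβ : -1 < β) (n : ℕ) :
    X * genChebT α β n = C (1 - chebC α β n) * genChebT α β (n + 1)
      + C (chebC α β n) * genChebT α β (n - 1) := by
  rcases Nat.eq_zero_or_pos n with rfl | hn
  · have h0 := genChebT_two_mul α β 0
    have h1 := genChebT_two_mul_add_one α β 0
    simp only [mul_zero, zero_add] at h0 h1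
    simp [chebC_zero, h0, h1, jacZ_zero]
  obtain ⟨m, rfl | rfl⟩ := n.even_or_odd'
  · obtain ⟨m, rfl⟩ : ∃ j, m = j + 1 := ⟨m - 1, by omega⟩
    have hm : (0 : ℝ) ≤ m := m.cast_nonneg
    have hne : 2 * ((m + 1 : ℕ) : ℝ) + α + β + 1 ≠ 0 := by push_cast; linarith
    have h := congrArg zSubst (jacZ_even_add α (α + β + 1) m)
    simp only [map_mul, map_add, zSubst_C] at h
    rw [one_sub_chebC_even hα hβ (by omega), chebC_even, genChebT_two_mul,
      genChebT_two_mul_add_one, show 2 * (m + 1) - 1 = 2 * m + 1 by omega,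
      genChebT_two_mul_add_one]
    apply mul_left_cancel₀ (C_ne_zero.mpr hne)
    simp only [mul_add, ← mul_assoc, ← C_mul, mul_div_cancel₀ _ hne]
    simp only [map_mul, map_add, map_ofNat, map_one, map_natCast, Nat.cast_succ] at h ⊢
    linear_combination X * h
  · have hm : (0 : ℝ) ≤ m := m.cast_nonneg
    have hne : 2 * (m : ℝ) + α + β + 2 ≠ 0 := by linarith
    have h := congrArg zSubst (jacZ_odd_add hα (α + β + 1) m)
    simp only [map_mul, map_add, map_sub, map_one, zSubst_C, zSubst_X] at h
    rw [one_sub_chebC_odd hα hβ, chebC_odd, genChebT_two_mul_add_one,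
      show 2 * m + 1 + 1 = 2 * (m + 1) by ring, genChebT_two_mul,
      show 2 * m + 1 - 1 = 2 * m by omega, genChebT_two_mul]
    apply mul_left_cancel₀ (C_ne_zero.mpr hne)
    simp only [mul_add, ← mul_assoc, ← C_mul, mul_div_cancel₀ _ hne]
    simp only [map_mul, map_add, map_ofNat, map_one, map_natCast] at h ⊢
    linear_combination h

theorem genChebT_zero (α β : ℝ) : genChebT α β 0 = 1 := by
  have := genChebT_two_mul α β 0
  rw [mul_zero] at this
  rw [this, jacZ_zero, map_one]

theorem genChebBasis_apply {α β : ℝ} (hα : -1 < α) (hβ : -1 < β) (n : ℕ) :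
    genChebBasis hα hβ n = genChebT α β n :=
  Polynomial.Sequence.basis_eq_self _ _ _

/-! ### Orthogonality functional and symmetric triple products -/

/-- The normalized orthogonality functional of the generalized Chebyshev polynomials. -/
def chebFun {α β : ℝ} (hα : -1 < α) (hβ : -1 < β) : ℝ[X] →ₗ[ℝ] ℝ := (genChebBasis hα hβ).coord 0

theorem chebFun_genChebT {α β : ℝ} (hα : -1 < α) (hβ : -1 < β) (n : ℕ) :
    chebFun hα hβ (genChebT α β n) = if n = 0 then 1 else 0 := by
  rw [chebFun, ← genChebBasis_apply hα hβ, Module.Basis.coord_apply, Module.Basis.repr_self,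
    Finsupp.single_apply]

theorem chebFun_C_mul {α β : ℝ} (hα : -1 < α) (hβ : -1 < β) (r : ℝ) (f : ℝ[X]) :
    chebFun hα hβ (C r * f) = r * chebFun hα hβ f := by
  rw [← smul_eq_C_mul, map_smul, smul_eq_mul]

/-- The symmetric triple products of generalized Chebyshev polynomials. -/
def chebTriple {α β : ℝ} (hα : -1 < α) (hβ : -1 < β) (m n k : ℕ) : ℝ :=
  chebFun hα hβ (genChebT α β m * genChebT α β n * genChebT α β k)

section
variable {α β : ℝ} (hα : -1 < α) (hβ : -1 < β)

theorem chebTriple_comm_left (m n k : ℕ) : chebTriple hα hβ m n k = chebTriple hα hβ n m k := by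
  rw [chebTriple, chebTriple, mul_comm (genChebT α β m)]

theorem chebTriple_comm_right (m n k : ℕ) : chebTriple hα hβ m n k = chebTriple hα hβ m k n := by
  rw [chebTriple, chebTriple, mul_right_comm]

/-- Multiplication by x may be moved from T_n to T_k. The truncated n - 1 and k - 1 at index 0 are
harmless, because `chebC` vanishes there. -/
theorem chebTriple_recurrence (m n k : ℕ) :
    (1 - chebC α β n) * chebTriple hα hβ m (n + 1) k + chebC α β n * chebTriple hα hβ m (n - 1) k
      = (1 - chebC α β k) * chebTriple hα hβ m n (k + 1)
        + chebC α β k * chebTriple hα hβ m n (k - 1) := by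
  simp only [chebTriple, ← chebFun_C_mul, ← map_add]
  congr 1
  linear_combination genChebT α β m * genChebT α β n * X_mul_genChebT hα hβ k
    - genChebT α β m * genChebT α β k * X_mul_genChebT hα hβ n

theorem chebTriple_zero_zero (n : ℕ) : chebTriple hα hβ 0 0 n = if n = 0 then 1 else 0 := by
  rw [chebTriple, genChebT_zero, one_mul, one_mul, chebFun_genChebT]

theorem chebTriple_zero_of_lt {m n : ℕ} (h : m < n) : chebTriple hα hβ 0 m n = 0 := by
  induction m using Nat.strong_induction_on generalizing n with
  | _ m ih =>
    cases m with
    | zero => rw [chebTriple_zero_zero, if_neg (by omega)]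
    | succ m =>
      have hr := chebTriple_recurrence hα hβ 0 m n
      rw [ih m (by omega) (by omega : m < n + 1), ih m (by omega) (by omega : m < n - 1),
        ih (m - 1) (by omega) (by omega : m - 1 < n)] at hr
      have := (one_sub_chebC_pos hα hβ m).ne'
      simpa [this] using hr

theorem chebTriple_zero_of_ne {m n : ℕ} (h : m ≠ n) : chebTriple hα hβ 0 m n = 0 := by
  rcases lt_or_gt_of_ne h with h | h
  · exact chebTriple_zero_of_lt hα hβ h
  · rw [chebTriple_comm_right]; exact chebTriple_zero_of_lt hα hβ h

theorem chebTriple_norm_succ (n : ℕ) :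
    (1 - chebC α β n) * chebTriple hα hβ 0 (n + 1) (n + 1)
      = chebC α β (n + 1) * chebTriple hα hβ 0 n n := by
  have hr := chebTriple_recurrence hα hβ 0 n (n + 1)
  rw [chebTriple_zero_of_ne hα hβ (by omega : n - 1 ≠ n + 1),
    chebTriple_zero_of_ne hα hβ (by omega : n ≠ n + 1 + 1)] at hr
  simpa using hr

theorem chebTriple_norm_pos (n : ℕ) : 0 < chebTriple hα hβ 0 n n := by
  induction n with
  | zero => rw [chebTriple_zero_zero]; simp
  | succ n ih =>
    have h := chebTriple_norm_succ hα hβ n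
    have h1 := one_sub_chebC_pos hα hβ n
    have h2 := mul_pos (chebC_pos hα hβ n.succ_pos) ih
    rw [← h] at h2
    exact (mul_pos_iff_of_pos_left h1).mp h2

/-- Pairing with T_k and a multiple of the k-th coordinate are linear functionals that agree on the
basis. Since the norm is positive, signs of g_T become signs of triple products. -/
theorem gT_mul_norm (m n k : ℕ) :
    gT hα hβ m n k * chebTriple hα hβ 0 k k = chebTriple hα hβ m n k := by
  have h : (chebFun hα hβ).comp (LinearMap.mulRight ℝ (genChebT α β k))
      = chebTriple hα hβ 0 k k • (genChebBasis hα hβ).coord k := by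
    refine (genChebBasis hα hβ).ext fun j => ?_
    rw [LinearMap.comp_apply, LinearMap.mulRight_apply, LinearMap.smul_apply,
      Module.Basis.coord_apply, Module.Basis.repr_self, genChebBasis_apply, Finsupp.single_apply,
      smul_eq_mul]
    have e : chebFun hα hβ (genChebT α β j * genChebT α β k) = chebTriple hα hβ 0 j k := by
      rw [chebTriple, genChebT_zero, one_mul]
    rw [e]
    split_ifs with hj
    · rw [hj, mul_one]
    · rw [chebTriple_zero_of_ne hα hβ hj, mul_zero]
  have := LinearMap.congr_fun h (genChebT α β m * genChebT α β n)
  rw [LinearMap.comp_apply, LinearMap.mulRight_apply, LinearMap.smul_apply,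
    Module.Basis.coord_apply, smul_eq_mul] at this
  rw [gT, mul_comm, ← this, chebTriple]

theorem gT_nonneg_iff (m n k : ℕ) : 0 ≤ gT hα hβ m n k ↔ 0 ≤ chebTriple hα hβ m n k := by
  rw [← gT_mul_norm]
  exact (mul_nonneg_iff_of_pos_right (chebTriple_norm_pos hα hβ k)).symm

theorem gT_pos_iff (m n k : ℕ) : 0 < gT hα hβ m n k ↔ 0 < chebTriple hα hβ m n k := by
  rw [← gT_mul_norm]
  exact (mul_pos_iff_of_pos_right (chebTriple_norm_pos hα hβ k)).symm

theorem chebTriple_eq_zero_of_lt {m n k : ℕ} (h : n + k < m) : chebTriple hα hβ m n k = 0 := by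
  induction k using Nat.strong_induction_on generalizing n with
  | _ k ih =>
    cases k with
    | zero =>
      rw [chebTriple_comm_right, chebTriple_comm_left]
      exact chebTriple_zero_of_ne hα hβ (by omega)
    | succ k =>
      have hr := chebTriple_recurrence hα hβ m n k
      rw [ih k (by omega) (by omega : n + 1 + k < m), ih k (by omega) (by omega : n - 1 + k < m),
        ih (k - 1) (by omega) (by omega : n + (k - 1) < m)] at hr
      have := (one_sub_chebC_pos hα hβ k).ne'
      simpa [this, eq_comm] using hr

theorem chebTriple_eq_zero_of_odd {m n k : ℕ} (h : Odd (m + n + k)) :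
    chebTriple hα hβ m n k = 0 := by
  induction k using Nat.strong_induction_on generalizing n with
  | _ k ih =>
    cases k with
    | zero =>
      rw [chebTriple_comm_right, chebTriple_comm_left]
      refine chebTriple_zero_of_ne hα hβ ?_
      rintro rfl
      exact (Nat.not_odd_iff_even.mpr ⟨m, by omega⟩) h
    | succ k =>
      have hr := chebTriple_recurrence hα hβ m n k
      rw [Nat.odd_iff] at h
      have e1 : chebC α β n * chebTriple hα hβ m (n - 1) k = 0 := by
        rcases Nat.eq_zero_or_pos n with rfl | hn
        · rw [chebC_zero, zero_mul]
        · rw [ih k (by omega) (by rw [Nat.odd_iff]; omega), mul_zero]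
      have e2 : chebC α β k * chebTriple hα hβ m n (k - 1) = 0 := by
        rcases Nat.eq_zero_or_pos k with rfl | hn
        · rw [chebC_zero, zero_mul]
        · rw [ih (k - 1) (by omega) (by rw [Nat.odd_iff]; omega), mul_zero]
      rw [e1, e2, ih k (by omega) (by rw [Nat.odd_iff]; omega : Odd (m + (n + 1) + k))] at hr
      have := (one_sub_chebC_pos hα hβ k).ne'
      simpa [this, eq_comm] using hr

theorem chebTriple_top_succ (m k : ℕ) :
    (1 - chebC α β k) * chebTriple hα hβ m (m + (k + 1)) (k + 1)
      = chebC α β (m + k + 1) * chebTriple hα hβ m (m + k) k := by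
  have hr := chebTriple_recurrence hα hβ m (m + k + 1) k
  have e1 : chebTriple hα hβ m (m + k + 1 + 1) k = 0 := by
    rw [chebTriple_comm_left]; exact chebTriple_eq_zero_of_lt hα hβ (by omega)
  have e2 : chebTriple hα hβ m (m + k + 1) (k - 1) = 0 := by
    rw [chebTriple_comm_left]; exact chebTriple_eq_zero_of_lt hα hβ (by omega)
  rw [e1, e2] at hr
  simp only [add_tsub_cancel_right, mul_zero, zero_add, add_zero] at hr
  exact hr.symm

theorem chebTriple_top_pos (m k : ℕ) : 0 < chebTriple hα hβ m (m + k) k := by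
  induction k with
  | zero =>
    rw [add_zero, chebTriple_comm_right, chebTriple_comm_left]
    exact chebTriple_norm_pos hα hβ m
  | succ k ih =>
    have h := chebTriple_top_succ hα hβ m k
    have h2 := mul_pos (chebC_pos hα hβ (m + k).succ_pos) ih
    rw [Nat.succ_eq_add_one, ← h] at h2
    exact (mul_pos_iff_of_pos_left (one_sub_chebC_pos hα hβ k)).mp h2

end

/-! ### Products next to the extremal one -/

/-- The partial sums of the coefficients in the monic three-term recurrence. -/
def chebGamma (α β : ℝ) (n : ℕ) : ℝ :=
  if Even n then n * (n + 2 * β) / (4 * (n + α + β))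
  else (n - 1) * (n + 2 * β + 1) / (4 * (n + α + β))

theorem chebGamma_even (α β : ℝ) (n : ℕ) :
    chebGamma α β (2 * n) = n * (n + β) / (2 * n + α + β) := by
  rw [chebGamma, if_pos (even_two_mul n)]
  push_cast
  rw [show (2 * (n : ℝ)) * (2 * n + 2 * β) = 4 * (n * (n + β)) by ring,
    mul_div_mul_left _ _ four_ne_zero]

theorem chebGamma_odd (α β : ℝ) (n : ℕ) :
    chebGamma α β (2 * n + 1) = n * (n + β + 1) / (2 * n + α + β + 1) := by
  rw [chebGamma, if_neg (by simp)]
  push_cast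
  rw [show (2 * (n : ℝ) + 1 - 1) * (2 * n + 1 + 2 * β + 1) = 4 * (n * (n + β + 1)) by ring,
    mul_div_mul_left _ _ four_ne_zero]
  congr 1; ring

section
variable {α β : ℝ} (hα : -1 < α) (hβ : -1 < β)
include hα hβ

/-- The monic multiples p_n of T_n satisfy x p_n = p_(n+1) + λ_n p_(n-1) with λ_n the added term.
Hence `chebGamma` is minus the coefficient of x^(n-2) in p_n. -/
theorem chebGamma_succ (n : ℕ) :
    chebGamma α β (n + 1) = chebGamma α β n + (1 - chebC α β (n - 1)) * chebC α β n := by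
  obtain ⟨m, rfl | rfl⟩ := n.even_or_odd'
  · cases m with
    | zero =>
      have h0 := chebGamma_even α β 0
      have h1 := chebGamma_odd α β 0
      simp only [mul_zero, zero_add] at h0 h1
      simp [h0, h1, chebC_zero]
    | succ m =>
      have hm : (0 : ℝ) ≤ m := m.cast_nonneg
      have h1 : 2 * ((m : ℝ) + 1) + α + β + 1 ≠ 0 := by linarith
      have h2 : 2 * ((m : ℝ) + 1) + α + β ≠ 0 := by linarith
      rw [show 2 * (m + 1) - 1 = 2 * m + 1 by omega, one_sub_chebC_odd hα hβ, chebC_even,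
        chebGamma_odd, chebGamma_even]
      push_cast
      rw [show 2 * (m : ℝ) + α + β + 2 = 2 * ((m : ℝ) + 1) + α + β by ring]
      generalize hs : 2 * ((m : ℝ) + 1) + α + β = s at *
      obtain rfl : α = s - 2 * ((m : ℝ) + 1) - β := by linarith
      field_simp
      ring
  · rw [show 2 * m + 1 - 1 = 2 * m by omega, show 2 * m + 1 + 1 = 2 * (m + 1) by ring,
      chebC_odd, chebGamma_odd, chebGamma_even]
    cases m with
    | zero => simp [chebC_zero]; ring
    | succ m =>
      have hm : (0 : ℝ) ≤ m := m.cast_nonneg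
      have h1 : 2 * ((m : ℝ) + 1) + α + β + 1 ≠ 0 := by linarith
      have h2 : 2 * ((m : ℝ) + 1) + α + β + 2 ≠ 0 := by linarith
      rw [one_sub_chebC_even hα hβ m.succ_pos]
      push_cast
      rw [show 2 * ((m : ℝ) + 1 + 1) + α + β = 2 * ((m : ℝ) + 1) + α + β + 2 by ring]
      generalize hs : 2 * ((m : ℝ) + 1) + α + β = s at *
      obtain rfl : α = s - 2 * ((m : ℝ) + 1) - β := by linarith
      field_simp
      ring

/-- The triple product next to the extremal one, in terms of the extremal one. -/
theorem chebTriple_second_top (m y : ℕ) :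
    chebTriple hα hβ (m + 1) (m + y) (y + 1) * (chebC α β (m + y + 1) * chebC α β (m + y + 2))
      = (chebGamma α β (m + y + 2) - chebGamma α β (m + 1) - chebGamma α β (y + 1))
        * chebTriple hα hβ (m + 1) (m + 1 + (y + 1)) (y + 1) := by
  -- In monic terms, p_i p_j has p_(i+j-2)-coefficient Γ_(i+j) - Γ_i - Γ_j, by comparing second
  -- coefficients; here i = m + 1, j = y + 1. The `chebC` factors account for the norms.
  induction y with
  | zero =>
    have h1 := chebTriple_recurrence hα hβ (m + 1) m 0
    have h2 := chebTriple_top_succ hα hβ (m + 1) 0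
    have h3 : chebTriple hα hβ (m + 1) (m - 1) 0 = 0 := by
      rw [chebTriple_comm_right, chebTriple_comm_left]
      exact chebTriple_zero_of_ne hα hβ (by omega)
    have h4 := chebGamma_succ hα hβ (m + 1)
    have h5 : chebGamma α β 1 = 0 := by simp [chebGamma]
    rw [add_tsub_cancel_right] at h4
    rw [h3, chebC_zero] at h1
    rw [chebC_zero] at h2
    simp only [add_zero, zero_add, sub_zero, one_mul, zero_mul, mul_zero, add_assoc,
      Nat.reduceAdd] at *
    rw [h2, ← h1, h4, h5]
    ring
  | succ y ih =>
    have h1 := chebTriple_recurrence hα hβ (m + 1) (m + 1 + y) (y + 1)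
    have h2 := chebTriple_top_succ hα hβ (m + 1) (y + 1)
    have h3 := chebTriple_top_succ hα hβ (m + 1) y
    have h4 := chebGamma_succ hα hβ (m + y + 2)
    have h5 := chebGamma_succ hα hβ (y + 1)
    have h6 := (one_sub_chebC_pos hα hβ (y + 1)).ne'
    rw [show m + 1 + y - 1 = m + y by omega, show y + 1 - 1 = y by omega,
      show m + 1 + y + 1 = m + 1 + (y + 1) by ring] at h1
    rw [show m + 1 + (y + 1) + 1 = m + y + 3 by ring] at h2
    rw [show m + 1 + y + 1 = m + y + 2 by ring] at h3
    rw [show m + y + 2 - 1 = m + y + 1 by omega] at h4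
    rw [show y + 1 - 1 = y by omega] at h5
    rw [show m + (y + 1) + 1 = m + y + 2 by ring, show m + (y + 1) + 2 = m + y + 3 by ring, h4, h5,
      show m + (y + 1) = m + 1 + y by ring]
    rw [show m + 1 + y = m + y + 1 by ring] at *
    apply mul_left_cancel₀ h6
    simp only [add_assoc, Nat.reduceAdd] at *
    linear_combination (-chebC α β (m + (y + 2)) * chebC α β (m + (y + 3))) * h1
      + chebC α β (m + (y + 3)) * ih
      - (chebGamma α β (m + (y + 2)) + (1 - chebC α β (m + (y + 1))) * chebC α β (m + (y + 2))
        - chebGamma α β (m + 1) - (chebGamma α β (y + 1) + (1 - chebC α β y) * chebC α β (y + 1)))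
        * h2 + (chebC α β (y + 1)) * chebC α β (m + (y + 3)) * h3

end

/-! ### Relations between triple products with two odd indices -/

/-- Triple products with two odd indices and an even one. -/
def oddTriple {α β : ℝ} (hα : -1 < α) (hβ : -1 < β) (m n k : ℕ) : ℝ :=
  chebTriple hα hβ (2 * m + 1) (2 * n + 1) (2 * k)

section
variable {α β : ℝ} (hα : -1 < α) (hβ : -1 < β)

theorem oddTriple_comm (m n k : ℕ) : oddTriple hα hβ m n k = oddTriple hα hβ n m k :=
  chebTriple_comm_left hα hβ _ _ _

theorem chebFun_zSubst_C_mul (r : ℝ) (f : ℝ[X]) :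
    chebFun hα hβ (zSubst (C r * f)) = r * chebFun hα hβ (zSubst f) := by
  rw [map_mul, zSubst_C, chebFun_C_mul]

theorem chebFun_zSubst_odd (m n k : ℕ) :
    chebFun hα hβ (zSubst ((1 - X) * jacZ α (α + β + 1 + 1) m
      * (jacZ α (α + β + 1 + 1) n * jacZ α (α + β + 1) k))) = oddTriple hα hβ m n k := by
  rw [oddTriple, chebTriple, genChebT_two_mul_add_one, genChebT_two_mul_add_one, genChebT_two_mul]
  simp only [map_mul, map_sub, map_one, zSubst_X]
  congr 1
  ring

theorem chebFun_zSubst_even (m n k : ℕ) :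
    chebFun hα hβ (zSubst (jacZ α (α + β + 1) k
      * (jacZ α (α + β + 1) m * jacZ α (α + β + 1) n)))
      = chebTriple hα hβ (2 * m) (2 * n) (2 * k) := by
  rw [chebTriple, genChebT_two_mul, genChebT_two_mul, genChebT_two_mul]
  simp only [map_mul]
  congr 1
  ring

/-- Symmetry of the operator, without integrals: on the eigenbasis either the eigenvalue difference
or the pairing is zero. The factor 1 - X is x², from the two odd polynomials. -/
theorem chebFun_jacOp_odd (p : ℕ) (f : ℝ[X]) :
    chebFun hα hβ (zSubst ((1 - X) * jacZ α (α + β + 1 + 1) p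
      * (jacOp α (α + β + 1 + 1) f + C (p * (p + (α + β + 1 + 1)) : ℝ) * f))) = 0 := by
  have hc : -1 < α + β + 1 + 1 := by linarith
  have h : (chebFun hα hβ).comp (zSubst.toLinearMap.comp
      ((LinearMap.mulLeft ℝ ((1 - X) * jacZ α (α + β + 1 + 1) p)).comp
        (jacOp α (α + β + 1 + 1)
          + LinearMap.mulLeft ℝ (C (p * (p + (α + β + 1 + 1)) : ℝ))))) = 0 := by
    refine LinearMap.ext_on (span_jacZ hα hc) ?_
    rintro _ ⟨j, rfl⟩
    simp only [LinearMap.comp_apply, LinearMap.add_apply, LinearMap.mulLeft_apply,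
      AlgHom.toLinearMap_apply, LinearMap.zero_apply, jacOp_jacZ hα]
    have e : zSubst ((1 - X) * jacZ α (α + β + 1 + 1) p
        * (-C (j * (j + (α + β + 1 + 1)) : ℝ) * jacZ α (α + β + 1 + 1) j
          + C (p * (p + (α + β + 1 + 1)) : ℝ) * jacZ α (α + β + 1 + 1) j))
        = C (p * (p + (α + β + 1 + 1)) - j * (j + (α + β + 1 + 1)) : ℝ)
          * (genChebT α β 0 * genChebT α β (2 * p + 1) * genChebT α β (2 * j + 1)) := by
      rw [genChebT_zero, genChebT_two_mul_add_one, genChebT_two_mul_add_one, C_sub]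
      simp only [map_mul, map_sub, map_add, map_neg, map_one, zSubst_X, zSubst_C]
      ring
    rw [e, chebFun_C_mul]
    by_cases hj : p = j
    · rw [hj]; ring
    · have := chebTriple_zero_of_ne hα hβ (by omega : 2 * p + 1 ≠ 2 * j + 1)
      rw [chebTriple] at this
      rw [this, mul_zero]
  exact LinearMap.congr_fun h f

theorem chebFun_jacOp_even (k : ℕ) (f : ℝ[X]) :
    chebFun hα hβ (zSubst (jacZ α (α + β + 1) k
      * (jacOp α (α + β + 1) f + C (k * (k + (α + β + 1)) : ℝ) * f))) = 0 := by
  have hc : -1 < α + β + 1 := by linarith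
  have h : (chebFun hα hβ).comp (zSubst.toLinearMap.comp
      ((LinearMap.mulLeft ℝ (jacZ α (α + β + 1) k)).comp
        (jacOp α (α + β + 1) + LinearMap.mulLeft ℝ (C (k * (k + (α + β + 1)) : ℝ))))) = 0 := by
    refine LinearMap.ext_on (span_jacZ hα hc) ?_
    rintro _ ⟨j, rfl⟩
    simp only [LinearMap.comp_apply, LinearMap.add_apply, LinearMap.mulLeft_apply,
      AlgHom.toLinearMap_apply, LinearMap.zero_apply, jacOp_jacZ hα]
    have e : zSubst (jacZ α (α + β + 1) k
        * (-C (j * (j + (α + β + 1)) : ℝ) * jacZ α (α + β + 1) j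
          + C (k * (k + (α + β + 1)) : ℝ) * jacZ α (α + β + 1) j))
        = C (k * (k + (α + β + 1)) - j * (j + (α + β + 1)) : ℝ)
          * (genChebT α β 0 * genChebT α β (2 * k) * genChebT α β (2 * j)) := by
      rw [genChebT_zero, genChebT_two_mul, genChebT_two_mul, C_sub]
      simp only [map_mul, map_add, map_neg, zSubst_C]
      ring
    rw [e, chebFun_C_mul]
    by_cases hj : k = j
    · rw [hj]; ring
    · have := chebTriple_zero_of_ne hα hβ (by omega : 2 * k ≠ 2 * j)
      rw [chebTriple] at this
      rw [this, mul_zero]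
  exact LinearMap.congr_fun h f

/-- A relation between two neighbouring triple products with two odd indices and one with even
indices only. -/
theorem oddTriple_even_relation (m n k : ℕ) :
    (2 * m + 2 + (α + β + 1)) * (n + α + 1)
        * (k * (k + (α + β + 1)) - (m + 1) * (m + 1 + (α + β + 1)) - (n + 1) * (n + (α + β + 1)))
        * chebTriple hα hβ (2 * (m + 1)) (2 * (n + 1)) (2 * k)
      = (n + 1) * ((m + 1 + (α + β + 1))
          * (k * (k + (α + β + 1)) - (n - m - 1) * (n - m - 1 + (α + β + 1)))
          * oddTriple hα hβ (m + 1) n k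
        + (m + 1) * (k * (k + (α + β + 1))
            - (m + n + 1 + (α + β + 1)) * (m + n + 1 + 2 * (α + β + 1)))
          * oddTriple hα hβ m n k) := by
  have h := chebFun_jacOp_even hα hβ k (jacZ α (α + β + 1) (m + 1) * jacPrim α (α + β + 1) n)
  rw [jacOp_mul_jacPrim hα (jacOp_jacZ hα (α + β + 1) (m + 1))] at h
  have e0 := X_mul_derivative_jacZ_succ' α (α + β + 1) m
  have e1 := jacZ_even_add α (α + β + 1) m
  rw [← chebFun_zSubst_even, ← chebFun_zSubst_odd, ← chebFun_zSubst_odd]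
  simp only [jacPrim] at h
  generalize α + β + 1 = c at *
  generalize jacZ α c (m + 1) = f at *
  generalize jacZ α (c + 1) (m + 1) = o1 at *
  generalize jacZ α (c + 1) m = o0 at *
  generalize jacZ α c (n + 1) = g at *
  generalize jacZ α (c + 1) n = o at *
  generalize jacZ α c k = e at *
  -- The factor 2m + 2 + c is what `e0` and `e1` need to express f and X f' through the neighbouring
  -- odd polynomials `o1` and `o0`.
  have key : C (2 * m + 2 + c) * (e * (-C (((m + 1 : ℕ) : ℝ) * (((m + 1 : ℕ) : ℝ) + c)
        + (n + 1) * (n + c)) * (f * (C (n + α + 1) * g - C (n + 1 : ℝ) * ((1 - X) * o)))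
      - C ((n + 1) * (n + c)) * (f * ((1 - X) * o))
      - C (2 * ((n + 1) * (n + c))) * (X * derivative f * ((1 - X) * o))
      + C (k * (k + c)) * (f * (C (n + α + 1) * g - C (n + 1 : ℝ) * ((1 - X) * o)))))
      = C ((2 * m + 2 + c) * (n + α + 1) * (k * (k + c) - (m + 1) * (m + 1 + c)
          - (n + 1) * (n + c))) * (e * (f * g))
        - C ((n + 1) * (m + 1 + c) * (k * (k + c) - (n - m - 1) * (n - m - 1 + c)))
            * ((1 - X) * o1 * (o * e))
        - C ((n + 1) * (m + 1) * (k * (k + c) - (m + n + 1 + c) * (m + n + 1 + 2 * c)))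
            * ((1 - X) * o0 * (o * e)) := by
    simp only [map_add, map_mul, map_sub, map_one, map_ofNat, map_natCast, Nat.cast_succ] at e0 e1 ⊢
    linear_combination (-2 * ((n : ℝ[X]) + 1) * (n + C c) * (1 - X) * o * e) * e0
      + (e * (1 - X) * o) * (-((n : ℝ[X]) + 1) * (k * (k + C c) - (m + 1) * (m + 1 + C c)
          - (n + 1) * (n + C c)) - (n + 1) * (n + C c)) * e1
  have h' := congrArg (fun t => chebFun hα hβ (zSubst t)) key
  simp only [chebFun_zSubst_C_mul, map_sub zSubst, map_sub (chebFun hα hβ), h, mul_zero] at h'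
  linear_combination -h'

/-- A relation between three triple products sharing an odd index. -/
theorem oddTriple_relation (p n k : ℕ) :
    (2 * (n + 1) + (α + β + 1)) * (k + (α + β + 1))
        * ((p + 1) * (p + (α + β + 1)) + (n + 1) * (n + 1 + (α + β + 1)) - k * (k + (α + β + 1)))
        * oddTriple hα hβ p k (n + 1)
      = (n + 1 + (α + β + 1)) * (n + 1 + k + (α + β + 1))
          * ((p + 1) * (p + (α + β + 1)) - (n + 1 - k) * (n + 1 - k + 1 - (α + β + 1)))
          * oddTriple hα hβ p (n + 1) k
        + (n + 1) * (n + 1 - k) * ((n + 1 + k + (α + β + 1)) * (n + k + 2 * (α + β + 1))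
            - (p + 1) * (p + (α + β + 1))) * oddTriple hα hβ p n k := by
  have h := chebFun_jacOp_odd hα hβ p (X * (derivative (jacZ α (α + β + 1) (n + 1))
    * jacZ α (α + β + 1) k - jacZ α (α + β + 1) (n + 1) * derivative (jacZ α (α + β + 1) k)))
  rw [jacOp_wronskian (jacOp_jacZ hα (α + β + 1) (n + 1)) (jacOp_jacZ hα (α + β + 1) k)] at h
  have e0 := X_mul_derivative_jacZ_succ' α (α + β + 1) n
  have e1 := jacZ_even_add α (α + β + 1) n
  have e2 := X_mul_derivative_jacZ α (α + β + 1) k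
  rw [← chebFun_zSubst_odd hα hβ p k, ← chebFun_zSubst_odd, ← chebFun_zSubst_odd]
  generalize α + β + 1 = c at *
  generalize jacZ α c (n + 1) = f at *
  generalize jacZ α (c + 1) (n + 1) = o1 at *
  generalize jacZ α (c + 1) n = o0 at *
  generalize jacZ α c k = g at *
  generalize jacZ α (c + 1) k = o at *
  generalize jacZ α (c + 1) p = e at *
  have key : C (2 * (n + 1) + c) * ((1 - X) * e
      * (C c * (X * (derivative f * g - f * derivative g))
        - C (((n + 1 : ℕ) : ℝ) * (((n + 1 : ℕ) : ℝ) + c) - k * (k + c)) * (f * g)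
        - C (((n + 1 : ℕ) : ℝ) * (((n + 1 : ℕ) : ℝ) + c) - k * (k + c)) * (X * derivative (f * g))
        + C (p * (p + (c + 1))) * (X * (derivative f * g - f * derivative g))))
      = C ((n + 1 + c) * (n + 1 + k + c) * ((p + 1) * (p + c) - (n + 1 - k) * (n + 1 - k + 1 - c)))
          * ((1 - X) * e * (o1 * g))
        + C ((n + 1) * (n + 1 - k) * ((n + 1 + k + c) * (n + k + 2 * c) - (p + 1) * (p + c)))
          * ((1 - X) * e * (o0 * g))
        - C ((2 * (n + 1) + c) * (k + c)
          * ((p + 1) * (p + c) + (n + 1) * (n + 1 + c) - k * (k + c)))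
          * ((1 - X) * e * (o * f)) := by
    simp only [map_add, map_mul, map_sub, map_one, map_ofNat, map_natCast, Nat.cast_succ,
      derivative_mul] at e0 e1 e2 ⊢
    linear_combination ((1 - X) * e * g * ((p + 1) * (p + C c) + k * (k + C c)
          - (n + 1) * (n + 1 + C c))) * e0
      - ((1 - X) * e * f * (2 * (n + 1) + C c) * ((p + 1) * (p + C c) - k * (k + C c)
          + (n + 1) * (n + 1 + C c))) * e2
      + ((1 - X) * e * g) * ((k * (k + C c) - (n + 1) * (n + 1 + C c))
        + (k + C c) * ((p + 1) * (p + C c) - k * (k + C c) + (n + 1) * (n + 1 + C c))) * e1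
  have h' := congrArg (fun t => chebFun hα hβ (zSubst t)) key
  simp only [chebFun_zSubst_C_mul, map_sub zSubst, map_add zSubst, map_sub (chebFun hα hβ),
    map_add (chebFun hα hβ), h, mul_zero] at h'
  linear_combination h'

end

/-! ### The step relation and closed forms near the extremal product -/

section
variable {α β a b : ℝ} (hα : -1 < α) (hβ : -1 < β)

/-- A three-term relation between triple products sharing the even index. -/
theorem oddTriple_step (ha : α + β + 1 = a) (hb : α - β = b) (m n k : ℕ) :
    (2 * n + 2 + a) * (m + α + 1) * ((n + 1) * (n + 1 + a) + (m + 1) * (m + a) - k * (k + a))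
        * ((n + 1) * (m + 1 + a) * ((k - (n - m) + 1) * (k + (n - m) - 1 + a)))
        * oddTriple hα hβ (m + 1) n k
      = (2 * m + 2 + a) * (n + α + 1)
          * ((m + 1) * (m + 1 + a) + (n + 1) * (n + a) - k * (k + a))
          * ((m + 1) * (n + 1 + a) * ((k - (n - m) - 1 + a) * (k + (n - m) + 1)))
          * oddTriple hα hβ m (n + 1) k
        + (m + 1) * (n + 1) * ((m + n + 1 + a - k) * (m + n + 1 + 2 * a + k))
          * ((n - m) / 2 * (b * ((2 * m + 2 + a) * (2 * n + 2 + a))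
            + (1 - b) * (2 * (k ^ 2 - (n - m) ^ 2) + 2 * k * a + a ^ 2 - a)))
          * oddTriple hα hβ m n k := by
  have h1 := oddTriple_even_relation hα hβ m n k
  have h2 := oddTriple_even_relation hα hβ n m k
  rw [chebTriple_comm_left, oddTriple_comm hα hβ (n + 1), oddTriple_comm hα hβ n] at h2
  -- Eliminating the all-even product from `h1` and `h2` leaves, at O(m,n,k), this difference up to
  -- common factors. It is antisymmetric in m and n, hence divisible by n - m.
  have hB : ((n : ℝ) - m) / 2 * (b * ((2 * m + 2 + a) * (2 * n + 2 + a))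
        + (1 - b) * (2 * (k ^ 2 - (n - m) ^ 2) + 2 * k * a + a ^ 2 - a))
      = (2 * n + 2 + a) * (m + α + 1) * ((n + 1) * (n + 1 + a) + (m + 1) * (m + a) - k * (k + a))
        - (2 * m + 2 + a) * (n + α + 1)
          * ((m + 1) * (m + 1 + a) + (n + 1) * (n + a) - k * (k + a)) := by
    obtain rfl : α = (a + b - 1) / 2 := by linarith
    ring
  rw [hB]
  rw [ha] at h1 h2
  linear_combination
    (-(2 * n + 2 + a) * (m + α + 1)
      * ((n + 1) * (n + 1 + a) + (m + 1) * (m + a) - k * (k + a))) * h1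
    + ((2 * m + 2 + a) * (n + α + 1)
      * ((m + 1) * (m + 1 + a) + (n + 1) * (n + a) - k * (k + a))) * h2

theorem oddTriple_top_pos (m k : ℕ) : 0 < oddTriple hα hβ m (m + k) k := by
  have := chebTriple_top_pos hα hβ (2 * m + 1) (2 * k)
  rwa [show 2 * m + 1 + 2 * k = 2 * (m + k) + 1 by ring] at this

theorem oddTriple_eq_zero {m n k : ℕ} (h : m + k < n) : oddTriple hα hβ m n k = 0 := by
  rw [oddTriple_comm]
  exact chebTriple_eq_zero_of_lt hα hβ (by omega)

/-- The triple product next to the extremal one for two odd indices. -/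
theorem oddTriple_second_top (ha : α + β + 1 = a) (hb : α - β = b) (m d : ℕ) :
    oddTriple hα hβ (m + 1) (m + 1 + d) (d + 1)
        * ((m + d + 2) * (2 * m + 2 * d + 5 + a - b) * (2 * d + 1 + a) * (2 * m + 2 + a))
      = (d + 1) * (2 * m + 2 * d + 5 + a) * (b * ((2 * m + 2 * d + 4 + a) * (2 * m + 2 + a))
          + (1 - b) * (a * (2 * d + 1 + a)))
        * oddTriple hα hβ (m + 1) (m + 1 + d + 1) (d + 1) := by
  have h := chebTriple_second_top hα hβ (2 * (m + 1)) (2 * d + 1)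
  rw [show 2 * (m + 1) + (2 * d + 1) + 1 = 2 * (m + d + 2) by ring,
    show 2 * (m + 1) + (2 * d + 1) + 2 = 2 * (m + d + 2) + 1 by ring,
    show 2 * (m + 1) + (2 * d + 1) = 2 * (m + 1 + d) + 1 by ring,
    show 2 * d + 1 + 1 = 2 * (d + 1) by ring,
    show 2 * (m + 1) + 1 + 2 * (d + 1) = 2 * (m + 1 + d + 1) + 1 by ring,
    chebC_even, chebC_odd, chebGamma_odd, chebGamma_odd, chebGamma_even] at h
  change oddTriple hα hβ _ _ _ * _ = _ * oddTriple hα hβ _ _ _ at h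
  generalize oddTriple hα hβ (m + 1) (m + 1 + d) (d + 1) = D at *
  generalize oddTriple hα hβ (m + 1) (m + 1 + d + 1) (d + 1) = U at *
  have hm : (0 : ℝ) ≤ m := m.cast_nonneg
  have hd : (0 : ℝ) ≤ d := d.cast_nonneg
  obtain rfl : α = (a + b - 1) / 2 := by linarith
  obtain rfl : β = (a - b - 1) / 2 := by linarith
  push_cast at h
  rw [show 2 * (m + d + 2 : ℝ) + (a + b - 1) / 2 + (a - b - 1) / 2 + 1 = 2 * m + 2 * d + 4 + a by
      ring, show 2 * (m + d + 2 : ℝ) + (a + b - 1) / 2 + (a - b - 1) / 2 + 2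
      = 2 * m + 2 * d + 4 + a + 1 by ring,
    show 2 * (m + 1 : ℝ) + (a + b - 1) / 2 + (a - b - 1) / 2 + 1 = 2 * m + 2 + a by ring,
    show 2 * (d + 1 : ℝ) + (a + b - 1) / 2 + (a - b - 1) / 2 = 2 * d + 1 + a by ring] at h
  have h1 : 2 * m + 2 * d + 4 + a ≠ 0 := by linarith
  have h2 : 2 * m + 2 * d + 4 + a + 1 ≠ 0 := by linarith
  have h3 : 2 * m + 2 + a ≠ 0 := by linarith
  have h4 : 2 * d + 1 + a ≠ 0 := by linarith
  generalize hs : 2 * m + 2 * d + 4 + a = s at *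
  generalize hr : s + 1 = r at *
  generalize hp : 2 * m + 2 + a = p at *
  generalize hq : 2 * d + 1 + a = q at *
  have h5 : D * ((m + d + 2) * (m + d + 2 + (a - b - 1) / 2 + 1)) * (p * q)
      = ((m + d + 2) * (m + d + 2 + (a - b - 1) / 2 + 1) * (p * q)
        - (m + 1) * (m + 1 + (a - b - 1) / 2 + 1) * (q * s)
        - (d + 1) * (d + 1 + (a - b - 1) / 2) * (p * s)) * r * U := by
    field_simp at h
    linear_combination h / 2
  subst hr hs hp hq
  linear_combination 2 * h5
end

/-! ### The inequality for the third extremal product -/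

/-- The polynomial inequality behind the positivity of the third extremal triple product. -/
theorem third_top_inequality {a b u κ : ℝ} (ha : a < 0) (ha' : -(1 / 3) < a) (hb : 0 < b)
    (hb' : b < 1) (hab : 0 ≤ a ^ 2 + 2 * b ^ 2 + 3 * a) (hu : 3 + a ≤ u) (hκ : 3 ≤ κ) :
    0 < a * (κ + a) * ((u + κ) ^ 2 - (1 - b) ^ 2) * (u + 1)
          * (u * (u + κ) - ((2 + a) * κ + a ^ 2))
        + (κ - 1) * (b * ((u + 1) * (u + κ)) + (1 - b) * ((2 + a) * κ + a ^ 2)) * (u + κ + 1)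
          * (b * ((u + κ) * (u - 1)) + (1 - b) * (a * (κ + a))) := by
  obtain ⟨s, rfl⟩ : ∃ s, κ = s - u := ⟨u + κ, by ring⟩
  set κ := s - u with hκs
  rw [show u + κ = s by rw [hκs]; ring]
  set ρ := (2 + a) * κ + a ^ 2 with hρ
  have hs : κ + 8 / 3 ≤ s := by linarith
  have hu2 : 8 / 3 ≤ u := by linarith
  have hκa : 0 < κ + a := by linarith
  have hρ0 : 0 < ρ := by nlinarith
  -- the leading coefficients
  have h1 : -a * (κ + a) ≤ (κ - 1) * b ^ 2 := by
    -- At κ = 3 the bound is exactly `hab`. Raising κ by one adds -a on the left and b² on the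
    -- right.
    have : 0 ≤ b ^ 2 + a := by nlinarith
    nlinarith
  -- the mixed terms
  have h2 : 0 ≤ ρ * (u - 1) + a * (κ + a) * (u + 1) := by
    have e : ρ * (u - 1) + a * (κ + a) * (u + 1)
        = (κ + a) * ((2 + 2 * a) * u - 2) - 2 * a * (u - 1) := by rw [hρ]; ring
    rw [e]
    have : 0 ≤ (2 + 2 * a) * u - 2 := by nlinarith
    have := mul_nonneg hκa.le this
    have := mul_nonneg (by linarith : 0 ≤ -a) (by linarith : 0 ≤ u - 1)
    linarith
  have h3 : (κ - 1) * (s + 1) * ρ ≤ (u + 1) * s ^ 2 * ((1 + a) * (κ + a - 1)) := by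
    -- The constants are matched so that 7/5 · 5/6 = 7/6, and κ + 5/3 ≤ s - 1 yields `i3`.
    have i1 : 7 / 5 * (2 + a) ≤ (u + 1) * (1 + a) := by nlinarith
    have i2 : 5 / 6 * (κ - 1) ≤ κ + a - 1 := by linarith
    have i3 : (κ + 5 / 3) * (s + 1) ≤ s ^ 2 := by nlinarith
    have i4 : ρ ≤ 7 / 6 * (2 + a) * (κ + 5 / 3) := by rw [hρ]; nlinarith
    calc (κ - 1) * (s + 1) * ρ ≤ (κ - 1) * (s + 1) * (7 / 6 * (2 + a) * (κ + 5 / 3)) :=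
          mul_le_mul_of_nonneg_left i4 (mul_nonneg (by linarith) (by linarith))
      _ = (7 / 5 * (2 + a)) * ((κ + 5 / 3) * (s + 1)) * (5 / 6 * (κ - 1)) := by ring
      _ ≤ ((u + 1) * (1 + a)) * s ^ 2 * (κ + a - 1) := by
          apply mul_le_mul _ i2 (by linarith)
          · exact mul_nonneg (mul_nonneg (by linarith) (by linarith)) (sq_nonneg s)
          · apply mul_le_mul i1 i3 (mul_nonneg (by linarith) (by linarith))
            exact mul_nonneg (by linarith) (by linarith)
      _ = _ := by ring
  have h4 : 0 < u * s - ρ := by rw [hρ]; nlinarith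
  have hc : (1 - b) ^ 2 < 1 := by nlinarith
  have hta : 0 < -a * (κ + a) := mul_pos (by linarith) hκa
  have p1 : 0 ≤ ((κ - 1) * b ^ 2 - -a * (κ + a)) * ((s + 1) * ((u + 1) * (u - 1) * s ^ 2)) :=
    mul_nonneg (by linarith) (mul_nonneg (by linarith)
      (mul_nonneg (mul_nonneg (by linarith) (by linarith)) (sq_nonneg s)))
  have p2 : 0 ≤ (κ - 1) * (s + 1) * (b * (1 - b) * s)
      * (ρ * (u - 1) + a * (κ + a) * (u + 1)) :=
    mul_nonneg (mul_nonneg (mul_nonneg (by linarith) (by linarith))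
      (mul_nonneg (mul_nonneg hb.le (by linarith)) (by linarith))) h2
  have p3 : 0 < -a * (κ + a) * (1 - b) ^ 2 * ((u + 1) * (u * s - ρ)) :=
    mul_pos (mul_pos hta (pow_pos (by linarith) 2)) (mul_pos (by linarith) h4)
  have p4 : 0 ≤ -a * (κ + a) * ((u + 1) * s ^ 2 * ((1 + a) * (κ + a - 1))
      - (κ - 1) * (s + 1) * ρ * (1 - b) ^ 2) := by
    refine mul_nonneg hta.le ?_
    have : 0 ≤ (κ - 1) * (s + 1) * ρ :=
      mul_nonneg (mul_nonneg (by linarith) (by linarith)) hρ0.le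
    linarith [mul_le_of_le_one_right this hc.le]
  have : ρ = (1 + a) * (κ + a - 1) + κ + 1 := by rw [hρ]; ring
  -- Four summands: the leading part for large u, controlled by `hab`; the mixed terms in b(1 - b);
  -- and two remainders, of which the one in `p3` is strictly positive.
  have e : a * (κ + a) * (s ^ 2 - (1 - b) ^ 2) * (u + 1) * (u * s - ρ)
        + (κ - 1) * (b * ((u + 1) * s) + (1 - b) * ρ) * (s + 1)
          * (b * (s * (u - 1)) + (1 - b) * (a * (κ + a)))
      = ((κ - 1) * b ^ 2 - -a * (κ + a)) * ((s + 1) * ((u + 1) * (u - 1) * s ^ 2))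
        + (κ - 1) * (s + 1) * (b * (1 - b) * s) * (ρ * (u - 1) + a * (κ + a) * (u + 1))
        + -a * (κ + a) * (1 - b) ^ 2 * ((u + 1) * (u * s - ρ))
        + -a * (κ + a) * ((u + 1) * s ^ 2 * ((1 + a) * (κ + a - 1))
      - (κ - 1) * (s + 1) * ρ * (1 - b) ^ 2) := by
    rw [show s = u + κ by rw [hκs]; ring]
    rw [hρ]
    ring
  rw [e]
  linarith

/-! ### Dominating odd index -/

section
variable {α β a b : ℝ} (hα : -1 < α) (hβ : -1 < β)

theorem three_term_regroup {L X Y Z p q r s t u v w x Ψ : ℝ}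
    (h : L * X = p * q * r * (s * (t * u)) * Y + v * w * (x * Ψ) * Z) :
    L * X = p * q * r * (s * u) * t * Y + v * w * x * Ψ * Z := by
  rw [h]; ring

/-- The defects d = n - m - 1, e = k + m - n, f = n - k are nonnegative on a triangle dominated by n
> m. In them every factor of `oddTriple_step` is visibly positive except the two kept explicit. -/
theorem oddTriple_step_signs (ha : α + β + 1 = a) (hb : α - β = b) (d e f : ℕ) :
    ∃ L R S : ℝ, 0 < L ∧ 0 < R ∧ 0 < S ∧
      L * oddTriple hα hβ (e + f + 1) (e + f + d + 1) (d + 1 + e)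
        = R * (e - 1 + a) * oddTriple hα hβ (e + f) (e + f + d + 2) (d + 1 + e)
          + S * (b * ((2 * (e + f) + 2 + a) * (2 * (e + f + d) + 4 + a))
            + (1 - b) * (2 * (e * (2 * d + 2 + e)) + 2 * (d + 1 + e) * a + a ^ 2 - a))
            * oddTriple hα hβ (e + f) (e + f + d + 1) (d + 1 + e) := by
  have ha1 : -1 < a := by linarith
  have hα1 : 0 < α + 1 := by linarith
  have hd : (0 : ℝ) ≤ d := d.cast_nonneg
  have he : (0 : ℝ) ≤ e := e.cast_nonneg
  have hf : (0 : ℝ) ≤ f := f.cast_nonneg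
  have q : 0 < ((e : ℝ) + f + d + 1 + 1) * (e + f + d + 1 + 1 + a)
      + (e + f + 1) * (e + f + a) - (d + 1 + e) * (d + 1 + e + a) := by
    have i1 : 0 ≤ (e + f) * (e + f + 1 + a) := mul_nonneg (by linarith) (by linarith)
    have i2 : 0 ≤ f * (2 * (d + 1 + e) + f + 2 + a) := mul_nonneg hf (by linarith)
    linarith
  have q' : 0 < ((e : ℝ) + f + 1) * (e + f + 1 + a)
      + (e + f + d + 1 + 1) * (e + f + d + 1 + a) - (d + 1 + e) * (d + 1 + e + a) := by
    have i1 : 0 < ((e : ℝ) + f + 1) * (e + f + 1 + a) := mul_pos (by linarith) (by linarith)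
    have i2 : 0 ≤ (f + 1) * (d + 1 + e + a + f) := mul_nonneg (by linarith) (by linarith)
    have i3 : 0 ≤ (d + 1 + e) * (f : ℝ) := by positivity
    linarith
  have hM : 0 < (e : ℝ) + f + 1 := by linarith
  have hN : 0 < (e : ℝ) + f + d + 1 + 1 := by linarith
  have hN' : 0 < (e : ℝ) + f + d + 1 + 1 + a := by linarith
  have hL := mul_pos (mul_pos (mul_pos (by linarith : 0 < 2 * ((e : ℝ) + f + d + 1) + 2 + a)
    (by linarith : 0 < (e : ℝ) + f + α + 1)) q) (mul_pos (mul_pos hN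
    (by linarith : 0 < (e : ℝ) + f + 1 + a)) (mul_pos (by linarith : 0 < (e : ℝ) + 1)
    (by linarith : 0 < 2 * (d : ℝ) + 1 + e + a)))
  have hR := mul_pos (mul_pos (mul_pos (by linarith : 0 < 2 * ((e : ℝ) + f) + 2 + a)
    (by linarith : 0 < (e : ℝ) + f + d + 1 + α + 1)) q') (mul_pos (mul_pos hM hN')
    (by linarith : 0 < 2 * (d : ℝ) + 2 + e + 1))
  have hS := mul_pos (mul_pos (mul_pos hM hN) (mul_pos (by linarith : 0 < (e : ℝ) + 2 * f + 1 + a)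
    (by linarith : 0 < 3 * (e : ℝ) + 2 * f + 2 * d + 3 + 2 * a)))
    (by linarith : 0 < ((d : ℝ) + 1) / 2)
  refine ⟨_, _, _, hL, hR, hS, ?_⟩
  have h := oddTriple_step hα hβ ha hb (e + f) (e + f + d + 1) (d + 1 + e)
  push_cast at h
  rw [show (e : ℝ) + f + d + 1 - (e + f) = d + 1 by ring] at h
  rw [show (d : ℝ) + 1 + e - (d + 1) + 1 = e + 1 by ring,
    show (d : ℝ) + 1 + e + (d + 1) - 1 + a = 2 * d + 1 + e + a by ring,
    show (d : ℝ) + 1 + e - (d + 1) - 1 + a = e - 1 + a by ring,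
    show (d : ℝ) + 1 + e + (d + 1) + 1 = 2 * d + 2 + e + 1 by ring,
    show (e : ℝ) + f + (e + f + d + 1) + 1 + a - (d + 1 + e) = e + 2 * f + 1 + a by ring,
    show (e : ℝ) + f + (e + f + d + 1) + 1 + 2 * a + (d + 1 + e)
      = 3 * e + 2 * f + 2 * d + 3 + 2 * a by ring,
    show ((d : ℝ) + 1 + e) ^ 2 - (d + 1) ^ 2 = e * (2 * d + 2 + e) by ring,
    show 2 * ((e : ℝ) + f + d + 1) + 2 + a = 2 * (e + f + d) + 4 + a by ring] at h
  rw [show 2 * ((e : ℝ) + f + d + 1) + 2 + a = 2 * (e + f + d) + 4 + a by ring]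
  exact three_term_regroup h

/-- The defects parametrizing a triangle with dominating odd index. -/
theorem exists_of_le_of_le_of_lt {m n k : ℕ} (h1 : m + 1 ≤ n) (h2 : k ≤ n) (h3 : n ≤ m + k) :
    ∃ d e f : ℕ, m = e + f ∧ n = e + f + d + 1 ∧ k = d + 1 + e :=
  ⟨n - m - 1, k + m - n, n - k, by omega, by omega, by omega⟩

theorem oddTriple_nonneg_of_le (ha : α + β + 1 = a) (hb : α - β = b) (ha0 : 0 ≤ a) (hb0 : 0 ≤ b)
    {m n k : ℕ} (hmn : m ≤ n) (hkn : k ≤ n) : 0 ≤ oddTriple hα hβ m n k := by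
  induction m generalizing n k with
  | zero =>
    rcases hkn.eq_or_lt with rfl | h
    · simpa using (oddTriple_top_pos hα hβ 0 k).le
    · rw [oddTriple_eq_zero hα hβ (by omega)]
  | succ m ih =>
    rcases lt_trichotomy n (m + 1 + k) with h | rfl | h
    · obtain ⟨d, e, f, rfl, rfl, rfl⟩ := exists_of_le_of_le_of_lt hmn hkn (by omega)
      obtain ⟨L, R, S, hL, hR, hS, h⟩ := oddTriple_step_signs hα hβ ha hb d e f
      refine (mul_nonneg_iff_of_pos_left hL).mp (h ▸ add_nonneg ?_ (mul_nonneg (mul_nonneg hS.le ?_)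
        (ih (by omega) hkn)))
      -- For e = 0 the coefficient may be negative, but its triple product violates the triangle
      -- inequality.
      · rcases e.eq_zero_or_pos with rfl | he
        · rw [oddTriple_eq_zero hα hβ (by omega), mul_zero]
        · have : (1 : ℝ) ≤ e := by exact_mod_cast he
          exact mul_nonneg (mul_nonneg hR.le (by linarith)) (ih (by omega) (by omega))
      · clear h hL hR hS ih
        have hd : (0 : ℝ) ≤ d := d.cast_nonneg
        have he : (0 : ℝ) ≤ e := e.cast_nonneg
        have hf : (0 : ℝ) ≤ f := f.cast_nonneg
        have i1 : 0 ≤ 2 * (e * (2 * d + 2 + e)) + 2 * (d + 1 + e) * a + a ^ 2 - a := by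
          have : 0 ≤ 2 * (e * (2 * d + 2 + e)) + 2 * (d + e) * a + a ^ 2 := by positivity
          linarith
        rcases le_total b 1 with hb1 | hb1
        · exact add_nonneg (by positivity) (mul_nonneg (by linarith) i1)
        -- For b ≥ 1 the bracket bP + (1 - b)Q is read as P + (b - 1)(P - Q).
        · have i2 : 0 ≤ (2 * (e + f) + 2 + a) * (2 * (e + f + d) + 4 + a)
              - (2 * (e * (2 * d + 2 + e)) + 2 * (d + 1 + e) * a + a ^ 2 - a) := by
            have : 0 ≤ 2 * e * (e : ℝ) + 4 * e * f + 4 * f * (f + d) + 8 * e + 12 * f + 4 * d + 8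
                + 2 * a * e + 4 * a * f + 5 * a  := by positivity
            nlinarith
          nlinarith [mul_nonneg (by linarith : 0 ≤ b - 1) i2,
            (by positivity : 0 ≤ (2 * (e + f) + 2 + a) * (2 * (e + f + d) + 4 + a))]
    · exact (oddTriple_top_pos hα hβ _ _).le
    · rw [oddTriple_eq_zero hα hβ h]

/-- Pure elimination of D: it substitutes the closed form of the second extremal product into the
step relation with e = 1. -/
theorem mul_eq_of_three_term {a A X U D p q s Q Ψ W r k m n N K u δ : ℝ}
    (h : A * X = p * (s / 2) * (Q / 2) * (m * N * (a * (2 * K))) * U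
      + m * n * (u * (2 * N)) * (δ / 2 * Ψ) * D)
    (h' : D * (n * q * k * u) = K * r * W * U) :
    A * (q * k) * X = (a * k * (s * q) * p * Q + 2 * δ * Ψ * r * W) * U * (m * N * K / 2) := by
  linear_combination (q * k) * h + m * N * δ * Ψ * h'

/-- The third extremal triple product in terms of the extremal one. -/
theorem oddTriple_third_top (ha : α + β + 1 = a) (hb : α - β = b) (d f : ℕ) :
    ∃ L : ℝ, 0 < L ∧ L * oddTriple hα hβ (f + 2) (f + d + 2) (d + 2)
      = (a * (2 * d + 3 + a) * ((2 * f + 3 + a + (2 * d + 3)) ^ 2 - (1 - b) ^ 2)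
          * (2 * f + 3 + a + 1) * ((2 * f + 3 + a) * (2 * f + 3 + a + (2 * d + 3))
            - ((2 + a) * (2 * d + 3) + a ^ 2))
        + (2 * d + 3 - 1) * (b * ((2 * f + 3 + a + 1) * (2 * f + 3 + a + (2 * d + 3)))
            + (1 - b) * ((2 + a) * (2 * d + 3) + a ^ 2)) * (2 * f + 3 + a + (2 * d + 3) + 1)
          * (b * ((2 * f + 3 + a + (2 * d + 3)) * (2 * f + 3 + a - 1))
            + (1 - b) * (a * (2 * d + 3 + a))))
        * oddTriple hα hβ (f + 1) (f + d + 3) (d + 2) := by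
  have ha1 : -1 < a := by linarith
  have hα1 : 0 < α + 1 := by linarith
  have hd : (0 : ℝ) ≤ d := d.cast_nonneg
  have hf : (0 : ℝ) ≤ f := f.cast_nonneg
  have hba : b < a + 1 := by linarith
  have hP : 0 < (f + 2) * (f + d + 3 + a) * ((d : ℝ) + 2) :=
    mul_pos (mul_pos (by linarith) (by linarith)) (by linarith)
  have hq : 0 < ((f : ℝ) + d + 2 + 1) * (f + d + 2 + 1 + a)
      + (f + 1 + 1) * (f + 1 + a) - (d + 2) * (d + 2 + a) := by
    have i1 : 0 ≤ (f + 1) * (f + 2 + a) := mul_nonneg (by linarith) (by linarith)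
    have i2 : 0 ≤ f * (2 * (d + 2) + f + 2 + a) := mul_nonneg hf (by linarith)
    linarith
  have hL := mul_pos (mul_pos (mul_pos (mul_pos
    (by linarith : 0 < 2 * ((f : ℝ) + d + 2) + 2 + a) (by linarith : 0 < (f : ℝ) + 1 + α + 1)) hq)
    (mul_pos (mul_pos (by linarith : 0 < (f : ℝ) + d + 2 + 1) (by linarith : 0 < (f : ℝ) + 1 + 1 + a))
    (mul_pos (by linarith : 0 < (d : ℝ) + 2 - (f + d + 2 - (f + 1)) + 1)
      (by linarith : 0 < (d : ℝ) + 2 + (f + d + 2 - (f + 1)) - 1 + a))))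
    (mul_pos (by linarith : 0 < 2 * (f : ℝ) + 2 * d + 7 + a - b) (by linarith : 0 < 2 * (d : ℝ) + 3 + a))
  refine ⟨_, div_pos hL (half_pos hP), ?_⟩
  rw [div_mul_eq_mul_div, div_eq_iff (half_pos hP).ne']
  have h := oddTriple_step hα hβ ha hb (f + 1) (f + d + 2) (d + 2)
  have h2 := oddTriple_second_top hα hβ ha hb f (d + 1)
  rw [show f + 1 + (d + 1) + 1 = f + d + 3 by ring, show f + 1 + (d + 1) = f + d + 2 by ring,
    show d + 1 + 1 = d + 2 by ring] at h2
  rw [show f + d + 2 + 1 = f + d + 3 by ring, show f + 1 + 1 = f + 2 by ring] at h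
  push_cast at h h2
  rw [show (d : ℝ) + 2 - (f + d + 2 - (f + 1)) - 1 + a = a by ring,
    show (d : ℝ) + 2 + (f + d + 2 - (f + 1)) + 1 = 2 * (d + 2) by ring,
    show (f : ℝ) + 1 + (f + d + 2) + 1 + a - (d + 2) = 2 * f + 2 + a by ring,
    show (f : ℝ) + 1 + (f + d + 2) + 1 + 2 * a + (d + 2) = 2 * (f + d + 2 + 1 + a) by ring,
    show (f : ℝ) + d + 2 - (f + 1) = d + 1 by ring,
    show (f : ℝ) + d + 2 + α + 1 = (2 * f + 2 * d + 5 + a + b) / 2 by linarith,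
    show ((f : ℝ) + 1 + 1) * (f + 1 + 1 + a) + (f + d + 2 + 1) * (f + d + 2 + a)
      - (d + 2) * (d + 2 + a) = ((2 * f + 3 + a) * (2 * f + 3 + a + (2 * d + 3))
            - ((2 + a) * (2 * d + 3) + a ^ 2)) / 2 by ring,
    show b * ((2 * (f + 1) + 2 + a) * (2 * (f + d + 2) + 2 + a))
        + (1 - b) * (2 * (((d : ℝ) + 2) ^ 2 - (d + 1) ^ 2) + 2 * (d + 2) * a + a ^ 2 - a)
      = b * ((2 * f + 3 + a + 1) * (2 * f + 3 + a + (2 * d + 3)))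
            + (1 - b) * ((2 + a) * (2 * d + 3) + a ^ 2) by ring] at h
  rw [show (f : ℝ) + (d + 1) + 2 = f + d + 2 + 1 by ring,
    show 2 * (f : ℝ) + 2 * (d + 1) + 5 + a = 2 * f + 2 * d + 7 + a by ring,
    show 2 * ((d : ℝ) + 1) + 1 + a = 2 * d + 3 + a by ring,
    show 2 * (f : ℝ) + 2 * (d + 1) + 4 + a = 2 * f + 3 + a + (2 * d + 3) by ring,
    show (d : ℝ) + 1 + 1 = d + 2 by ring] at h2
  rw [show (2 * (f : ℝ) + 3 + a + (2 * d + 3)) ^ 2 - (1 - b) ^ 2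
      = (2 * f + 2 * d + 5 + a + b) * (2 * f + 2 * d + 7 + a - b) by ring,
    show 2 * (d : ℝ) + 3 - 1 = 2 * (d + 1) by ring,
    show 2 * (f : ℝ) + 3 + a + (2 * d + 3) + 1 = 2 * f + 2 * d + 7 + a by ring,
    show 2 * (f : ℝ) + 3 + a + 1 = 2 * (f + 1) + 2 + a by ring,
    show 2 * (f : ℝ) + 3 + a - 1 = 2 * f + 2 + a by ring,
    show ((f : ℝ) + 2) * (f + d + 3 + a) * (d + 2)
      = (f + 1 + 1) * (f + d + 2 + 1 + a) * (d + 2) by ring,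
    show (f : ℝ) + d + 2 - (f + 1) = d + 1 by ring]
  rw [show 2 * (f : ℝ) + 3 + a + 1 = 2 * (f + 1) + 2 + a by ring] at h
  exact mul_eq_of_three_term h h2

theorem oddTriple_third_top_pos (ha : α + β + 1 = a) (hb : α - β = b) (ha0 : a < 0)
    (ha1 : -(1 / 3) < a) (hb0 : 0 < b) (hb1 : b < 1) (hab : 0 ≤ a ^ 2 + 2 * b ^ 2 + 3 * a)
    (d f : ℕ) : 0 < oddTriple hα hβ (f + 2) (f + d + 2) (d + 2) := by
  have h := oddTriple_third_top hα hβ ha hb d f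
  obtain ⟨L, hL, h⟩ := h
  have hd : (0 : ℝ) ≤ d := d.cast_nonneg
  have hf : (0 : ℝ) ≤ f := f.cast_nonneg
  -- Here u = 2f + 3 + a and κ = 2d + 3.
  have key := third_top_inequality ha0 ha1 hb0 hb1 hab (by linarith : 3 + a ≤ 2 * (f : ℝ) + 3 + a)
    (by linarith : (3 : ℝ) ≤ 2 * d + 3)
  refine (mul_pos_iff_of_pos_left hL).mp (h ▸ mul_pos key ?_)
  have := oddTriple_top_pos hα hβ (f + 1) (d + 2)
  rwa [show f + 1 + (d + 2) = f + d + 3 by ring] at this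

theorem oddTriple_pos_of_le (ha : α + β + 1 = a) (hb : α - β = b) (ha0 : a < 0)
    (ha1 : -(1 / 3) < a) (hb0 : 0 < b) (hb1 : b < 1) (hab : 0 ≤ a ^ 2 + 2 * b ^ 2 + 3 * a)
    {m n k : ℕ} (hmn : m ≤ n) (hkn : k ≤ n) (hn : n ≤ m + k) :
    0 < oddTriple hα hβ m n k := by
  induction m generalizing n k with
  | zero =>
    obtain rfl : n = k := by omega
    simpa using oddTriple_top_pos hα hβ 0 n
  | succ m ih =>
    rcases hn.lt_or_eq with h | rfl
    · obtain ⟨d, e, f, rfl, rfl, rfl⟩ := exists_of_le_of_le_of_lt hmn hkn (by omega)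
      have hd : (0 : ℝ) ≤ d := d.cast_nonneg
      have he : (0 : ℝ) ≤ e := e.cast_nonneg
      have hf : (0 : ℝ) ≤ f := f.cast_nonneg
      have hΨ : 0 < b * ((2 * (e + f) + 2 + a) * (2 * (e + f + d) + 4 + a))
            + (1 - b) * (2 * (e * (2 * d + 2 + e)) + 2 * (d + 1 + e) * a + a ^ 2 - a) := by
        -- If b < -2a, then 8a² > 2b² ≥ -a(3 + a), which gives a < -1/3.
        have i0 : -2 * a ≤ b := by nlinarith
        have i1 : (2 * d + 1) * a
            ≤ 2 * (e * (2 * d + 2 + e)) + 2 * (d + 1 + e) * a + a ^ 2 - a := by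
          have : 0 ≤ e * (2 * (2 * d + 2 + e) + 2 * a) := mul_nonneg he (by linarith)
          linarith [sq_nonneg a]
        have i2 : (1 - b) * ((2 * d + 1) * a)
            ≤ (1 - b) * (2 * (e * (2 * d + 2 + e)) + 2 * (d + 1 + e) * a + a ^ 2 - a) :=
          mul_le_mul_of_nonneg_left i1 (by linarith)
        have i3 : 2 * (d : ℝ) + 3 ≤ (2 * (e + f) + 2 + a) * (2 * (e + f + d) + 4 + a) := by
          have : 5 / 3 * (2 * (d : ℝ) + 11 / 3)
              ≤ (2 * (e + f) + 2 + a) * (2 * (e + f + d) + 4 + a) :=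
            mul_le_mul (by linarith) (by linarith) (by positivity) (by linarith)
          linarith
        have i4 := mul_le_mul i0 i3 (by positivity) hb0.le
        have i5 : 0 ≤ -(b * ((2 * d + 1) * a)) := by
          have := mul_nonneg hb0.le (mul_nonneg (by linarith : 0 ≤ 2 * (d : ℝ) + 1)
            (by linarith : 0 ≤ -a))
          linarith
        have i6 : 0 ≤ -(d * a) := by
          have := mul_nonneg hd (by linarith : 0 ≤ -a)
          linarith
        linarith
      -- The only defect for which e - 1 + a is negative while its product need not vanish.
      by_cases he1 : e = 1
      · subst he1
        have := oddTriple_third_top_pos hα hβ ha hb ha0 ha1 hb0 hb1 hab d f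
        rwa [show 1 + f + 1 = f + 2 by ring, show 1 + f + d + 1 = f + d + 2 by ring]
      obtain ⟨L, R, S, hL, hR, hS, h⟩ := oddTriple_step_signs hα hβ ha hb d e f
      refine (mul_pos_iff_of_pos_left hL).mp (h ▸ add_pos_of_nonneg_of_pos ?_
        (mul_pos (mul_pos hS hΨ) (ih (by omega) hkn (by omega))))
      rcases e.eq_zero_or_pos with rfl | he
      · rw [oddTriple_eq_zero hα hβ (by omega), mul_zero]
      · have : (2 : ℝ) ≤ e := by exact_mod_cast (by omega : 2 ≤ e)
        exact mul_nonneg (mul_nonneg hR.le (by linarith)) (ih (by omega) (by omega) (by omega)).le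
    · exact oddTriple_top_pos hα hβ _ _
end

/-! ### Dominating even index -/

section
variable {α β a b : ℝ} (hα : -1 < α) (hβ : -1 < β)

/-- The triple product next to the extremal one, with dominating even index. -/
theorem oddTriple_second_top_even_pos (ha : α + β + 1 = a) (hb : α - β = b) (ha0 : a < 0)
    (ha1 : -(1 / 3) < a) (hb0 : 0 < b) (hab : 0 ≤ a ^ 2 + 2 * b ^ 2 + 3 * a)
    {p k : ℕ} (hp : 0 < p) (hk : 0 < k) : 0 < oddTriple hα hβ p k (p + k) := by
  have h := chebTriple_second_top hα hβ (2 * p) (2 * k)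
  rw [chebTriple_comm_right, show 2 * p + 2 * k + 2 = 2 * (p + k + 1) by ring,
    show 2 * p + 2 * k = 2 * (p + k) by ring] at h
  change oddTriple hα hβ p k (p + k) * _ = _ at h
  have hc := mul_pos (chebC_pos hα hβ (by omega : 0 < 2 * (p + k) + 1))
    (chebC_pos hα hβ (by omega : 0 < 2 * (p + k + 1)))
  refine (mul_pos_iff_of_pos_right hc).mp (h ▸ mul_pos ?_ (chebTriple_top_pos hα hβ _ _))
  clear h hc
  have hp' : (1 : ℝ) ≤ p := by exact_mod_cast hp
  have hk' : (1 : ℝ) ≤ k := by exact_mod_cast hk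
  obtain rfl : α = (a + b - 1) / 2 := by linarith
  obtain rfl : β = (a - b - 1) / 2 := by linarith
  have e : chebGamma ((a + b - 1) / 2) ((a - b - 1) / 2) (2 * (p + k + 1))
      - chebGamma ((a + b - 1) / 2) ((a - b - 1) / 2) (2 * p + 1)
      - chebGamma ((a + b - 1) / 2) ((a - b - 1) / 2) (2 * k + 1)
      = (p + k + a) * (b * ((2 * p + a) * (2 * k + a)) + (1 - b) * a * (2 * p + 2 * k + 1 + a))
        / (2 * ((2 * p + 2 * k + 1 + a) * (2 * p + a) * (2 * k + a))) := by
    rw [chebGamma_even, chebGamma_odd, chebGamma_odd]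
    push_cast
    rw [show 2 * (p + k + 1 : ℝ) + (a + b - 1) / 2 + (a - b - 1) / 2 = 2 * p + 2 * k + 1 + a by ring,
      show 2 * (p : ℝ) + (a + b - 1) / 2 + (a - b - 1) / 2 + 1 = 2 * p + a by ring,
      show 2 * (k : ℝ) + (a + b - 1) / 2 + (a - b - 1) / 2 + 1 = 2 * k + a by ring]
    have h1 : 2 * (p : ℝ) + 2 * k + 1 + a ≠ 0 := by linarith
    have h2 : 2 * (p : ℝ) + a ≠ 0 := by linarith
    have h3 : 2 * (k : ℝ) + a ≠ 0 := by linarith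
    generalize hr : 2 * (p : ℝ) + 2 * k + 1 + a = r at *
    generalize hs : 2 * (p : ℝ) + a = s at *
    generalize ht : 2 * (k : ℝ) + a = t at *
    field_simp
    subst hr hs ht
    ring
  rw [e]
  have i0 : -2 * a ≤ b := by nlinarith
  have i1 : 5 / 3 ≤ 2 * (p : ℝ) + a := by linarith
  have i2 : 5 / 3 ≤ 2 * (k : ℝ) + a := by linarith
  have i3 : (2 * (p : ℝ) + 2 * k + 1 + a) < 2 * ((2 * p + a) * (2 * k + a)) := by
    nlinarith [mul_nonneg (sub_nonneg.mpr i1) (sub_nonneg.mpr i2)]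
  have i4 : 0 < (2 * p + a) * (2 * (k : ℝ) + a) := mul_pos (by linarith) (by linarith)
  refine div_pos (mul_pos (by linarith) ?_)
    (mul_pos two_pos (mul_pos (mul_pos (by linarith) (by linarith)) (by linarith)))
  have i5 : -2 * a * ((2 * p + a) * (2 * k + a)) ≤ b * ((2 * p + a) * (2 * k + a)) :=
    mul_le_mul_of_nonneg_right i0 i4.le
  have i6 : 0 < -a * (2 * ((2 * p + a) * (2 * k + a)) - (2 * (p : ℝ) + 2 * k + 1 + a)) :=
    mul_pos (by linarith) (by linarith)
  have i7 : 0 < b * -a * (2 * (p : ℝ) + 2 * k + 1 + a) :=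
    mul_pos (mul_pos hb0 (by linarith)) (by linarith)
  linarith

theorem oddTriple_even_top_pos (p k : ℕ) : 0 < oddTriple hα hβ p k (p + k + 1) := by
  have := chebTriple_top_pos hα hβ (2 * p + 1) (2 * k + 1)
  rwa [chebTriple_comm_right, show 2 * p + 1 + (2 * k + 1) = 2 * (p + k + 1) by ring] at this

/-- Both products on the right have their odd index n + 1 or n at least as large as the others, so
the earlier case applies. Only the coefficient kept explicit can change sign. -/
theorem oddTriple_relation_signs (ha : α + β + 1 = a) (ha1 : -(1 / 3) < a) {p n k : ℕ}
    (hpn : p ≤ n) (hk : 0 < k) (hp : 0 < p) (hkn : k ≤ n) :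
    ∃ L R S : ℝ, 0 < L ∧ 0 < R ∧ 0 < S ∧ L * oddTriple hα hβ p k (n + 1)
      = R * ((p + 1) * (p + a) - (n + 1 - k) * (n + 1 - k + 1 - a)) * oddTriple hα hβ p (n + 1) k
        + S * oddTriple hα hβ p n k := by
  have hp' : (1 : ℝ) ≤ p := by exact_mod_cast hp
  have hk' : (1 : ℝ) ≤ k := by exact_mod_cast hk
  have hpn' : (p : ℝ) ≤ n := by exact_mod_cast hpn
  have hkn' : (k : ℝ) ≤ n := by exact_mod_cast hkn
  have i1 : 0 < (p + 1) * (p + a) + (n + 1) * (n + 1 + a) - k * (k + a) := by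
    have : 0 < (p + 1) * (p + a) := mul_pos (by linarith) (by linarith)
    have : 0 ≤ (n + 1 - k) * (n + 1 + k + a) := mul_nonneg (by linarith) (by linarith)
    linarith
  have i2 : 0 < ((n : ℝ) + 1 + k + a) * (n + k + 2 * a) - (p + 1) * (p + a) := by
    have : ((p : ℝ) + 2 + a) * (p + 1 + 2 * a) ≤ (n + 1 + k + a) * (n + k + 2 * a) :=
      mul_le_mul (by linarith) (by linarith) (by linarith) (by linarith)
    have : 0 ≤ ((p : ℝ) + 2) * (a + 1 / 3) := mul_nonneg (by linarith) (by linarith)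
    linarith [sq_nonneg a]
  have h := oddTriple_relation hα hβ p n k
  rw [ha] at h
  refine ⟨_, _, _, ?_, ?_, ?_, h⟩
  · exact mul_pos (mul_pos (by linarith) (by linarith)) i1
  · exact mul_pos (by linarith) (by linarith)
  · exact mul_pos (mul_pos (by linarith) (by linarith)) i2

/-- The strict inequality matters: at n + 1 = p + k the expression equals a(2p + 1), which is
negative for a < 0. -/
theorem oddTriple_relation_coeff_pos {p n k : ℕ} (ha : -1 < a) (hkn : k ≤ n)
    (h : n + 1 < p + k) :
    0 < ((p : ℝ) + 1) * (p + a) - (n + 1 - k) * (n + 1 - k + 1 - a) := by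
  obtain ⟨d, rfl⟩ := Nat.exists_eq_add_of_le hkn
  obtain ⟨q, rfl⟩ := Nat.exists_eq_add_of_lt (by omega : d + 1 < p)
  push_cast
  have hd : (0 : ℝ) ≤ d := d.cast_nonneg
  have hq : (0 : ℝ) ≤ q := q.cast_nonneg
  have i1 : 0 < (2 * (d : ℝ) + q + 4) * (1 + a) := mul_pos (by linarith) (by linarith)
  have i2 : 0 ≤ (q : ℝ) * (2 * d + q + 3 + 1) := by positivity
  nlinarith

theorem oddTriple_nonneg_of_lt (ha : α + β + 1 = a) (hb : α - β = b) (ha0 : 0 ≤ a) (hb0 : 0 ≤ b)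
    {p k e : ℕ} (hpe : p < e) (hke : k < e) : 0 ≤ oddTriple hα hβ p k e := by
  obtain ⟨n, rfl⟩ : ∃ n, e = n + 1 := ⟨e - 1, by omega⟩
  rcases lt_trichotomy (n + 1) (p + k + 1) with h | h | h
  · obtain ⟨L, R, S, hL, hR, hS, hrel⟩ := oddTriple_relation_signs hα hβ ha (by linarith)
      (by omega : p ≤ n) (by omega : 0 < k) (by omega) (by omega)
    refine (mul_nonneg_iff_of_pos_left hL).mp (hrel ▸ add_nonneg (mul_nonneg (mul_nonneg hR.le ?_)
      (oddTriple_nonneg_of_le hα hβ ha hb ha0 hb0 (by omega) (by omega))) (mul_nonneg hS.le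
      (oddTriple_nonneg_of_le hα hβ ha hb ha0 hb0 (by omega) (by omega))))
    rcases (by omega : n + 1 < p + k ∨ n + 1 = p + k) with h' | h'
    · exact (oddTriple_relation_coeff_pos (by linarith) (by omega) h').le
    · have : (n : ℝ) + 1 = p + k := by exact_mod_cast h'
      rw [this]
      have : 0 ≤ a * (2 * p + 1) := by positivity
      linarith
  · rw [h]; exact (oddTriple_even_top_pos hα hβ p k).le
  · rw [oddTriple, chebTriple_comm_right, chebTriple_comm_left,
      chebTriple_eq_zero_of_lt hα hβ (by omega)]

theorem oddTriple_pos_of_lt (ha : α + β + 1 = a) (hb : α - β = b) (ha0 : a < 0)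
    (ha1 : -(1 / 3) < a) (hb0 : 0 < b) (hb1 : b < 1) (hab : 0 ≤ a ^ 2 + 2 * b ^ 2 + 3 * a)
    {p k e : ℕ} (hpe : p < e) (hke : k < e) (he : e ≤ p + k + 1) :
    0 < oddTriple hα hβ p k e := by
  obtain ⟨n, rfl⟩ : ∃ n, e = n + 1 := ⟨e - 1, by omega⟩
  rcases (by omega : n + 1 = p + k + 1 ∨ n + 1 = p + k ∨ n + 1 < p + k) with h | h | h
  · rw [h]; exact oddTriple_even_top_pos hα hβ p k
  · rw [h]
    exact oddTriple_second_top_even_pos hα hβ ha hb ha0 ha1 hb0 hab (by omega) (by omega)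
  · obtain ⟨L, R, S, hL, hR, hS, hrel⟩ := oddTriple_relation_signs hα hβ ha ha1
      (by omega : p ≤ n) (by omega : 0 < k) (by omega) (by omega)
    exact (mul_pos_iff_of_pos_left hL).mp (hrel ▸ add_pos (mul_pos (mul_pos hR
      (oddTriple_relation_coeff_pos (by linarith) (by omega) h))
      (oddTriple_pos_of_le hα hβ ha hb ha0 ha1 hb0 hb1 hab (by omega) (by omega) (by omega)))
      (mul_pos hS
      (oddTriple_pos_of_le hα hβ ha hb ha0 ha1 hb0 hb1 hab (by omega) (by omega) (by omega))))

theorem oddTriple_nonneg (ha : α + β + 1 = a) (hb : α - β = b) (ha0 : 0 ≤ a) (hb0 : 0 ≤ b)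
    (m n k : ℕ) : 0 ≤ oddTriple hα hβ m n k := by
  rcases (by omega : (m < k ∧ n < k) ∨ (m ≤ n ∧ k ≤ n) ∨ (n ≤ m ∧ k ≤ m)) with h | h | h
  · exact oddTriple_nonneg_of_lt hα hβ ha hb ha0 hb0 h.1 h.2
  · exact oddTriple_nonneg_of_le hα hβ ha hb ha0 hb0 h.1 h.2
  · rw [oddTriple_comm]; exact oddTriple_nonneg_of_le hα hβ ha hb ha0 hb0 h.1 h.2

theorem oddTriple_pos (ha : α + β + 1 = a) (hb : α - β = b) (ha0 : a < 0)
    (ha1 : -(1 / 3) < a) (hb0 : 0 < b) (hb1 : b < 1) (hab : 0 ≤ a ^ 2 + 2 * b ^ 2 + 3 * a)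
    {m n k : ℕ} (h1 : m ≤ n + k) (h2 : n ≤ m + k) (h3 : k ≤ m + n + 1) :
    0 < oddTriple hα hβ m n k := by
  rcases (by omega : (m < k ∧ n < k) ∨ (m ≤ n ∧ k ≤ n) ∨ (n ≤ m ∧ k ≤ m)) with h | h | h
  · exact oddTriple_pos_of_lt hα hβ ha hb ha0 ha1 hb0 hb1 hab h.1 h.2 h3
  · exact oddTriple_pos_of_le hα hβ ha hb ha0 ha1 hb0 hb1 hab h.1 h.2 h2
  · rw [oddTriple_comm]
    exact oddTriple_pos_of_le hα hβ ha hb ha0 ha1 hb0 hb1 hab h.1 h.2 h1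

end

/-! ### Necessity by limits along the extremal families -/

section
variable {α β a b : ℝ} (hα : -1 < α) (hβ : -1 < β)

theorem nonneg_of_forall_inv {g : ℝ → ℝ} (hg : Continuous g) (a : ℝ)
    (h : ∀ m : ℕ, 0 ≤ g (2 * m + 3 + a)⁻¹) : 0 ≤ g 0 := by
  have h1 : Filter.Tendsto (fun m : ℕ => (2 * (m : ℝ) + 3 + a)⁻¹) Filter.atTop (nhds 0) := by
    refine Filter.Tendsto.inv_tendsto_atTop ?_
    refine Filter.tendsto_atTop_add_const_right _ _ (Filter.tendsto_atTop_add_const_right _ _ ?_)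
    exact tendsto_natCast_atTop_atTop.const_mul_atTop two_pos
  exact ge_of_tendsto ((hg.tendsto 0).comp h1) (Filter.Eventually.of_forall h)

theorem nonneg_of_oddTriple_nonneg (ha : α + β + 1 = a) (hb : α - β = b)
    (h : ∀ m, 0 ≤ oddTriple hα hβ (m + 1) (m + 1) 1) : 0 ≤ b := by
  -- With x = 1/u and u = 2m + 3 + a, this is the bracket of `oddTriple_second_top` at d = 0 divided
  -- by u², since (2m + 4 + a)(2m + 2 + a) = u² - 1. Its value at x = 0 is b.
  have key := nonneg_of_forall_inv
    (g := fun x => b * (1 - x ^ 2) + (1 - b) * (a * (1 + a)) * x ^ 2) (by fun_prop) a fun m => by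
    have hm : (0 : ℝ) ≤ m := m.cast_nonneg
    have h1 := oddTriple_second_top hα hβ ha hb m 0
    have h2 := oddTriple_top_pos hα hβ (m + 1) 1
    have h3 := h m
    simp only [add_zero, zero_add, Nat.cast_zero, mul_zero] at h1
    have h4 : 0 ≤ ((m : ℝ) + 2) * (2 * m + 5 + a - b) * (1 + a) * (2 * m + 2 + a) :=
      mul_nonneg (mul_nonneg (mul_nonneg (by linarith) (by linarith)) (by linarith)) (by linarith)
    have h5 := mul_nonneg h3 h4
    rw [h1, mul_nonneg_iff_of_pos_right h2, mul_nonneg_iff_of_pos_left (by linarith)] at h5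
    have hu : 0 < 2 * (m : ℝ) + 3 + a := by linarith
    have e : b * (1 - (2 * (m : ℝ) + 3 + a)⁻¹ ^ 2) + (1 - b) * (a * (1 + a))
        * (2 * (m : ℝ) + 3 + a)⁻¹ ^ 2
        = (b * ((2 * m + 4 + a) * (2 * m + 2 + a)) + (1 - b) * (a * (1 + a)))
          * (2 * (m : ℝ) + 3 + a)⁻¹ ^ 2 := by
      rw [show (2 * (m : ℝ) + 4 + a) * (2 * m + 2 + a) = (2 * m + 3 + a) ^ 2 - 1 by ring]
      field_simp
    exact e ▸ mul_nonneg h5 (by positivity)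
  simpa using key

theorem quadratic_nonneg_of_oddTriple_nonneg (ha : α + β + 1 = a) (hb : α - β = b)
    (h : ∀ m, 0 ≤ oddTriple hα hβ (m + 2) (m + 2) 2) : 0 ≤ a ^ 2 + 2 * b ^ 2 + 3 * a := by
  -- The numerator of `oddTriple_third_top` at d = 0, that is κ = 3, divided by u^5. Its value at x
  -- = 0 is a(3 + a) + 2b².
  have key := nonneg_of_forall_inv
    (g := fun x => a * (3 + a) * ((1 + 3 * x) ^ 2 - (1 - b) ^ 2 * x ^ 2) * (1 + x)
            * (1 + 3 * x - ((2 + a) * 3 + a ^ 2) * x ^ 2)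
        + (3 - 1) * (b * ((1 + x) * (1 + 3 * x)) + (1 - b) * ((2 + a) * 3 + a ^ 2) * x ^ 2)
          * (1 + 3 * x + x)
          * (b * ((1 + 3 * x) * (1 - x)) + (1 - b) * (a * (3 + a)) * x ^ 2))
    (by fun_prop) a fun m => by
    have hm : (0 : ℝ) ≤ m := m.cast_nonneg
    obtain ⟨L, hL, h1⟩ := oddTriple_third_top hα hβ ha hb 0 m
    have h2 := oddTriple_top_pos hα hβ (m + 1) 2
    have h3 := mul_nonneg hL.le (h m)
    simp only [add_zero, zero_add, Nat.cast_zero, mul_zero] at h1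
    rw [h1, mul_nonneg_iff_of_pos_right h2] at h3
    have hu : 0 < 2 * (m : ℝ) + 3 + a := by linarith
    clear h1 hL h2 h
    generalize 2 * (m : ℝ) + 3 + a = u at *
    refine (mul_nonneg h3 (by positivity : 0 ≤ u⁻¹ ^ 5)).trans_eq ?_
    field_simp
  simp only [mul_zero] at key
  linarith

theorem exists_oddTriple {m n k : ℕ} (h : Odd m ∨ Odd n) (he : Even (m + n + k)) :
    ∃ p q r, chebTriple hα hβ m n k = oddTriple hα hβ p q r ∧
      (m ≤ n + k → n ≤ m + k → k ≤ m + n → p ≤ q + r ∧ q ≤ p + r ∧ r ≤ p + q + 1) := by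
  obtain ⟨m, rfl | rfl⟩ := m.even_or_odd' <;> obtain ⟨n, rfl | rfl⟩ := n.even_or_odd' <;>
    obtain ⟨k, rfl | rfl⟩ := k.even_or_odd'
  all_goals try (exfalso; simp only [Nat.odd_iff, Nat.even_iff] at h he; omega)
  · exact ⟨n, k, m, by rw [chebTriple_comm_left, chebTriple_comm_right]; rfl, by omega⟩
  · exact ⟨m, k, n, by rw [chebTriple_comm_right]; rfl, by omega⟩
  · exact ⟨m, n, k, rfl, by omega⟩

end

/-! ### Comparison of V with V', and the theorem -/

theorem setV_ssubset_setV' : setV ⊂ setV' := by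
  -- The witness has a = -1/4 and b = 3/5.
  refine (Set.ssubset_iff_of_subset ?_).mpr ⟨(-13 / 40, -37 / 40), ?_, ?_⟩
  · rintro ⟨α, β⟩ ⟨hα, hβ, h, hb⟩
    refine ⟨hα, hβ, ?_, hb⟩
    dsimp only at *
    have ha1 : -1 < α + β + 1 := by linarith
    generalize α + β + 1 = a at *
    generalize α - β = b at *
    rcases le_or_gt 0 a with ha | ha
    · positivity
    · by_contra! hc
      -- Twice the expression of V minus 24 + 7a - a² times that of V' equals 3a(a + 1)(a + 2)(a +
      -- 3), which is negative here.
      have i1 : 0 < 24 + 7 * a - a ^ 2 := by nlinarith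
      have i2 := mul_pos i1 (by linarith : 0 < -(a ^ 2 + 2 * b ^ 2 + 3 * a))
      have i3 : 0 ≤ -a * (a + 3) * (3 * ((a + 1) * (a + 2))) :=
        mul_nonneg (mul_nonneg (by linarith) (by linarith))
          (mul_nonneg (by norm_num) (mul_nonneg (by linarith) (by linarith)))
      linarith
  · refine ⟨by norm_num, by norm_num, ?_, ?_⟩ <;> norm_num
  · rintro ⟨-, -, h, -⟩
    norm_num at h

end

theorem theorem3p1 (α β : ℝ) (hα : -1 < α) (hβ : -1 < β) :
    ((∀ m n : ℕ, Odd m ∨ Odd n → ∀ k : ℕ, |(m : ℤ) - (n : ℤ)| ≤ (k : ℤ) → k ≤ m + n →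
        0 ≤ gT hα hβ m n k) ↔ (α, β) ∈ setV') ∧
    setV ⊂ setV' ∧
    ((α, β) ∈ setV' \ setDelta → ∀ m n : ℕ, Odd m ∨ Odd n →
      ∀ k : ℕ, |(m : ℤ) - (n : ℤ)| ≤ (k : ℤ) → k ≤ m + n → Even (m + n - k) →
        0 < gT hα hβ m n k) := by
  obtain ⟨a, ha⟩ : ∃ a, α + β + 1 = a := ⟨_, rfl⟩
  obtain ⟨b, hb⟩ : ∃ b, α - β = b := ⟨_, rfl⟩
  have hV : (α, β) ∈ setV' ↔ 0 ≤ a ^ 2 + 2 * b ^ 2 + 3 * a ∧ 0 ≤ b := by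
    simp only [setV', Set.mem_ofPred_eq, ha, hb, hα, hβ, true_and, ge_iff_le]
  have hpos : (α, β) ∈ setV' → a < 0 → ∀ m n : ℕ, Odd m ∨ Odd n →
      ∀ k : ℕ, |(m : ℤ) - (n : ℤ)| ≤ (k : ℤ) → k ≤ m + n → Even (m + n + k) →
        0 < gT hα hβ m n k := by
    rw [hV]
    rintro ⟨hab, hb0⟩ ha0 m n h k hk hk' he
    -- This is β > -1. Inserted in `hab` it gives 0 < 3a² + 7a + 2 = (3a + 1)(a + 2), hence a >
    -- -1/3.
    have hba : b < a + 1 := by linarith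
    have ha1 : -(1 / 3) < a := by nlinarith
    have hb1 : 0 < b := by nlinarith
    obtain ⟨p, q, r, e, ht⟩ := exists_oddTriple hα hβ h he
    obtain ⟨h1, h2⟩ := abs_le.mp hk
    obtain ⟨t1, t2, t3⟩ := ht (by omega) (by omega) hk'
    rw [gT_pos_iff, e]
    exact oddTriple_pos hα hβ ha hb ha0 ha1 hb1 (by linarith) hab t1 t2 t3
  refine ⟨⟨fun h => ?_, fun h m n hmn k hk hk' => ?_⟩, setV_ssubset_setV', fun h => ?_⟩
  · rw [hV]
    have key : ∀ m k : ℕ, k ≤ 2 * m + 1 → 0 ≤ oddTriple hα hβ m m k := fun m k hk =>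
      (gT_nonneg_iff hα hβ _ _ _).mp
        (h (2 * m + 1) (2 * m + 1) (Or.inl (odd_two_mul_add_one m)) (2 * k)
          (by simp) (by omega))
    exact ⟨quadratic_nonneg_of_oddTriple_nonneg hα hβ ha hb fun m => key _ _ (by omega),
      nonneg_of_oddTriple_nonneg hα hβ ha hb fun m => key _ _ (by omega)⟩
  · rcases Nat.even_or_odd (m + n + k) with he | ho
    · rcases le_or_gt 0 a with ha0 | ha0
      · obtain ⟨p, q, r, e, -⟩ := exists_oddTriple hα hβ hmn he
        rw [gT_nonneg_iff, e]
        exact oddTriple_nonneg hα hβ ha hb ha0 (hV.mp h).2 p q r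
      · exact (hpos h ha0 m n hmn k hk hk' he).le
    · rw [gT_nonneg_iff, chebTriple_eq_zero_of_odd hα hβ ho]
  · have ha0 : a < 0 := by
      by_contra! ha0
      refine h.2 ⟨hα, hβ, ?_, ?_⟩
      · exact ha0.trans_eq ha.symm
      · exact (hV.mp h.1).2.trans_eq hb.symm
    intro m n hmn k hk hk' he
    refine hpos h.1 ha0 m n hmn k hk hk' ?_
    -- No truncation occurs, since k ≤ m + n.
    rw [show m + n + k = m + n - k + 2 * k by omega]
    exact he.add (even_two_mul k)
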